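/- Let $\mathcal{D}$ be a triangulated category with translation functor $[1]$ in which every object is a finite direct sum of indecomposable objects, where an object is indecomposable if it is nonzero and is not isomorphic to a direct sum of two nonzero objects. Assume that $\mathcal{D}$ is a block: it is nonzero, and it does not decompose as $\mathcal{D}=\mathcal{D}_1\times\mathcal{D}_2$ with $\mathcal{D}_1,\mathcal{D}_2$ nonzero full triangulated subcategories (such a decomposition means that $\mathrm{Hom}_{\mathcal{D}}(\mathcal{D}_1,\mathcal{D}_2)=0=\mathrm{Hom}_{\mathcal{D}}(\mathcal{D}_2,\mathcal{D}_1)$ and every object of $\mathcal{D}$ is isomorphic to $X_1\oplus X_2$ with $X_i\in\mathcal{D}_i$). For indecomposable objects $X,Y$ of $\mathcal{D}$, a path from $X$ to $Y$ is a finite sequence $X=X_0,X_1,\dots,X_n=Y$ ($n\ge 0$) of indecomposable objects of $\mathcal{D}$ such that for each $1\le i\le n$ we have $\mathrm{Hom}_{\mathcal{D}}(X_{i-1},X_i)\ne 0$ or $X_i\cong X_{i-1}[1]$. An abelian category $\mathcal{H}$ is hereditary if $\mathrm{Ext}^n_{\mathcal{H}}(A,B)=0$ for all objects $A,B$ and all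 $n\ge 2$. The triangulated category $\mathcal{D}$ is hereditary if there are a hereditary abelian category $\mathcal{H}$ and an equivalence of categories $F\colon \mathbf{D}^b(\mathcal{H})\to\mathcal{D}$ that commutes with the translation functors up to a natural isomorphism ($F$ is not required to be a triangle equivalence). Then the following conditions are equivalent: 1. the triangulated category $\mathcal{D}$ is hereditary; 2. for every indecomposable object $X$ of $\mathcal{D}$ there is no path from $X[1]$ to $X$; 3. there is an indecomposable object $X$ of $\mathcal{D}$ with no path from $X[1]$ to $X$; 4. there are indecomposable objects $X,Y$ of $\mathcal{D}$ with no path from $Y$ to $X$. -/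

import Mathlib

open CategoryTheory CategoryTheory.Limits

universe v u

/-- An abelian category is hereditary if its extension groups `Ext^n(X, Y)` vanish
for all objects `X`, `Y` and all `n ≥ 2`. -/
def IsHereditaryAbelian (A : Type u) [Category.{v} A] [Abelian A] : Prop :=
  ∀ X : A, HasProjectiveDimensionLE X 1

section

variable (D : Type u) [Category.{v} D] [Preadditive D] [HasZeroObject D] [HasShift D ℤ]
  [∀ n : ℤ, (shiftFunctor D n).Additive] [Pretriangulated D]

/-- A triangulated category `D` is hereditary if there are a hereditary abelian category `A` and
an equivalence of categories `F : D^b(A) ≌ D` which commutes with the translation functors,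
i.e. `F(X[1]) ≅ F(X)[1]` naturally in `X`. The equivalence is not required to be a triangle
functor. -/
def IsHereditaryTriangulated : Prop :=
  ∃ (A : Type u) (_ : Category.{v} A) (_ : Abelian A),
    IsHereditaryAbelian A ∧
    letI := HasDerivedCategory.standard A
    ∃ F : DerivedCategory.Bounded A ≌ D,
      Nonempty (shiftFunctor (DerivedCategory.Bounded A) (1 : ℤ) ⋙ F.functor ≅
        F.functor ⋙ shiftFunctor D (1 : ℤ))

variable {D}

/-- `D` is the product `P × Q` of its full triangulated subcategories `P` and `Q`: there are no
nonzero morphisms between them in either direction, and each object of `D` is a direct sum of an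
object of `P` and an object of `Q`. -/
structure IsTriangulatedDecomposition (P Q : ObjectProperty D) : Prop where
  isTriangulated_left : P.IsTriangulated
  isTriangulated_right : Q.IsTriangulated
  hom_eq_zero : ∀ ⦃X Y : D⦄, P X → Q Y → ∀ f : X ⟶ Y, f = 0
  hom_eq_zero' : ∀ ⦃X Y : D⦄, P X → Q Y → ∀ f : Y ⟶ X, f = 0
  exists_iso_biprod : ∀ Z : D, ∃ X Y : D, P X ∧ Q Y ∧ Nonempty (Z ≅ X ⊞ Y)

variable (D)

/-- A triangulated category is a block if it is nonzero and, whenever it is the product of two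
full triangulated subcategories, one of these two is zero. -/
structure IsBlock : Prop where
  exists_not_isZero : ∃ X : D, ¬ IsZero X
  trivial_of_decomposition : ∀ P Q : ObjectProperty D, IsTriangulatedDecomposition P Q →
    (∀ X : D, P X → IsZero X) ∨ (∀ X : D, Q X → IsZero X)

/-- Each object of `D` is a finite (possibly empty) direct sum of indecomposable objects. -/
def HasIndecomposableDecompositions : Prop :=
  ∀ X : D, ∃ (n : ℕ) (Y : Fin n → D), (∀ i, Indecomposable (Y i)) ∧ Nonempty (X ≅ ⨁ Y)

variable {D}

/-- There is a path from `X` to `Y`: a finite sequence `X = Z₀, Z₁, …, Zₙ = Y` of indecomposable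
objects such that for each `i < n` we have `Hom(Zᵢ, Zᵢ₊₁) ≠ 0` or `Zᵢ₊₁ ≅ Zᵢ[1]`. -/
def HasPath (X Y : D) : Prop :=
  ∃ (n : ℕ) (Z : ℕ → D), Z 0 = X ∧ Z n = Y ∧ (∀ i ≤ n, Indecomposable (Z i)) ∧
    ∀ i < n, (∃ f : Z i ⟶ Z (i + 1), f ≠ 0) ∨ Nonempty (Z (i + 1) ≅ (Z i)⟦(1 : ℤ)⟧)

end

/-!
The crucial implication is that a block `D` without paths from `X⟦1⟧` to `X` is hereditary. A
nonzero morphism `X ⟶ Y` between indecomposable objects yields a path from `Y` to `X⟦1⟧`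
(`HasPath.reverse_of_hom`), and in a block any two indecomposable objects are joined by a path up to
a shift (`IsBlock.isLinked`). Fix an indecomposable object `X₀`. Among the shifts of each
indecomposable object there is then a first one that is reached by a path from `X₀`. The finite
direct sums of these first shifts form a full subcategory `H` such that
`Hom(X, Y⟦n⟧) = 0` for `X`, `Y` in `H` and `n ≠ 0, 1`, and such that every object of `D` is a finite
direct sum of shifts of objects of `H` (`IsPathFront.isHereditaryHeart`).

For such an `H`, the cone of a morphism `f` of `H` has summands in degrees `0` and `1` only, which
are the cokernel and the kernel of `f`. This makes `H` an abelian category whose short exact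
sequences are the distinguished triangles with terms in `H` (`IsHereditaryHeart.exists_abelian`).
As the morphisms of degree `2` vanish, those of degree `1` extend along monomorphisms, so that `H`
is hereditary (`IsHeartEmbedding.isHereditaryAbelian`).

The equivalence between `D` and the bounded derived category of `H` is not obtained from a
realization functor. Both categories consist of finite direct sums of shifts of objects of `H`,
with morphisms of degree `0`, given by `H`, and of degree `1`, given by the classes of short exact
sequences of `H` in both cases (`IsHeartEmbedding.extComparison`). Compositions of two morphisms of
degree `1` vanish, hence these identifications define a fully faithful functor on the shifts of
objects of `H` (`ExtComparison.functor`), which is extended to finite direct sums through the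
additive envelope (`ExtComparison.exists_functor`). That the bounded derived category of a
hereditary abelian category consists of such sums is `isFiniteSum_of_bounded`; this also gives each
indecomposable object of a hereditary triangulated category a degree, which does not decrease along
paths and which the shift raises by one (`IsHereditaryTriangulated.not_hasPath`).

Finally, if in a block there is a path from `Z⟦1⟧` to `Z`, then there are paths from `Z` to all its
shifts, and therefore between any two indecomposable objects
(`IsBlock.hasPath_of_hasPath_shift`).
-/

/-! ### Finite direct sums and indecomposable objects -/

section FiniteSums

universe v₁ u₁

variable {C : Type u₁} [Category.{v₁} C] [Preadditive C] [HasBinaryBiproducts C]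

/-- The objects which are iterated binary direct sums of objects satisfying `P`, the empty sum
being any zero object. -/
inductive IsFiniteSum (P : ObjectProperty C) : C → Prop
  | zero {X : C} (hX : IsZero X) : IsFiniteSum P X
  | add {X A B : C} (hA : IsFiniteSum P A) (hB : P B) (e : X ≅ A ⊞ B) : IsFiniteSum P X

namespace IsFiniteSum

variable {P Q : ObjectProperty C}

lemma of_iso {X Y : C} (e : X ≅ Y) (hX : IsFiniteSum P X) : IsFiniteSum P Y := by
  cases hX with
  | zero h => exact .zero (h.of_iso e.symm)
  | add hA hB e' => exact .add hA hB (e.symm ≪≫ e')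

lemma mono {X : C} (hPQ : ∀ X, P X → Q X) (hX : IsFiniteSum P X) : IsFiniteSum Q X := by
  induction hX with
  | zero h => exact .zero h
  | add hA hB e ih => exact .add ih (hPQ _ hB) e

/-- The biproduct with a zero object on the left. -/
lemma nonempty_iso_biprod_of_isZero {Z X : C} (hZ : IsZero Z) : Nonempty (X ≅ Z ⊞ X) :=
  ⟨{ hom := biprod.inr
     inv := biprod.snd
     hom_inv_id := by simp
     inv_hom_id := by
      ext
      · exact hZ.eq_of_src _ _
      · exact hZ.eq_of_src _ _
      · exact hZ.eq_of_tgt _ _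
      · simp }⟩

lemma nonempty_iso_biprod_of_isZero' {Z X : C} (hZ : IsZero Z) : Nonempty (X ≅ X ⊞ Z) := by
  obtain ⟨e⟩ := nonempty_iso_biprod_of_isZero (X := X) hZ
  exact ⟨e ≪≫ biprod.braiding _ _⟩

lemma of_prop [HasZeroObject C] {X : C} (hX : P X) : IsFiniteSum P X := by
  obtain ⟨e⟩ := nonempty_iso_biprod_of_isZero (X := X) (isZero_zero C)
  exact .add (.zero (isZero_zero C)) hX e

lemma biprod {X Y : C} (hX : IsFiniteSum P X) (hY : IsFiniteSum P Y) :
    IsFiniteSum P (X ⊞ Y) := by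
  induction hY with
  | zero h =>
    obtain ⟨e⟩ := nonempty_iso_biprod_of_isZero' (X := X) h
    exact of_iso e hX
  | add hA hB e ih =>
    exact .add ih hB (biprod.mapIso (Iso.refl X) e ≪≫ (biprod.associator _ _ _).symm)

/-- A property which contains the zero objects, is closed under isomorphisms and under binary
direct sums contains the finite direct sums of its objects. -/
lemma le_of_closed [Q.IsClosedUnderIsomorphisms] (h₀ : ∀ X : C, IsZero X → Q X)
    (hadd : ∀ X Y : C, Q X → Q Y → Q (X ⊞ Y)) (hPQ : ∀ X, P X → Q X) {X : C}
    (hX : IsFiniteSum P X) : Q X := by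
  induction hX with
  | zero h => exact h₀ _ h
  | add hA hB e ih => exact Q.prop_of_iso e.symm (hadd _ _ ih (hPQ _ hB))

lemma of_biproduct [HasFiniteBiproducts C] {n : ℕ} (Y : Fin n → C) (hY : ∀ i, P (Y i)) :
    IsFiniteSum P (⨁ Y) := by
  induction n with
  | zero =>
    refine .zero ?_
    rw [IsZero.iff_id_eq_zero]
    ext i
    exact i.elim0
  | succ n ih =>
    refine .add (ih (fun i ↦ Y i.castSucc) (fun i ↦ hY _)) (hY (Fin.last n))
      { hom := biprod.lift (biproduct.lift fun i ↦ biproduct.π Y i.castSucc)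
          (biproduct.π Y (Fin.last n))
        inv := biprod.desc (biproduct.desc fun i ↦ biproduct.ι Y i.castSucc)
          (biproduct.ι Y (Fin.last n))
        hom_inv_id := ?_
        inv_hom_id := ?_ }
    · rw [biprod.lift_desc, biproduct.lift_desc, ← biproduct.total, Fin.sum_univ_castSucc]
    · ext i j
      · simp [biproduct.ι_π]
      · simp [Fin.castSucc_ne_last]
      · simp [(Fin.castSucc_ne_last _).symm]
      · simp

/-- The summands of a finite direct sum may be assumed to satisfy any property shared by all the
direct summands. -/
lemma refine {X : C} (hX : IsFiniteSum P X)
    (h : ∀ ⦃B : C⦄ (i : B ⟶ X) (r : X ⟶ B), i ≫ r = 𝟙 B → P B → Q B) : IsFiniteSum Q X := by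
  induction hX with
  | zero h₀ => exact .zero h₀
  | @add X A B hA hB e ih =>
    refine .add (ih fun W i r hir hW ↦ h (i ≫ biprod.inl ≫ e.inv) (e.hom ≫ biprod.fst ≫ r) ?_ hW)
      (h (biprod.inr ≫ e.inv) (e.hom ≫ biprod.snd) (by simp) hB) e
    simpa using hir

lemma eq_zero_of_forall_to {X Y : C} (hY : IsFiniteSum P Y)
    (h : ∀ ⦃B : C⦄, P B → ∀ f : X ⟶ B, f = 0) (f : X ⟶ Y) : f = 0 := by
  induction hY with
  | zero hY => exact hY.eq_of_tgt _ _
  | @add Y A B hA hB e ih =>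
    rw [← cancel_mono e.hom, zero_comp]
    ext
    · simpa using ih (f ≫ e.hom ≫ biprod.fst)
    · simpa using h hB (f ≫ e.hom ≫ biprod.snd)

lemma eq_zero_of_forall_from {X Y : C} (hX : IsFiniteSum P X)
    (h : ∀ ⦃B : C⦄, P B → ∀ f : B ⟶ Y, f = 0) (f : X ⟶ Y) : f = 0 := by
  induction hX with
  | zero hX => exact hX.eq_of_src _ _
  | @add Y A B hA hB e ih =>
    rw [← cancel_epi e.inv, comp_zero]
    ext
    · simpa using ih (biprod.inl ≫ e.inv ≫ f)
    · simpa using h hB (biprod.inr ≫ e.inv ≫ f)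

/-- A finite direct sum can be split according to whether the summands satisfy `R` or not. -/
lemma exists_partition [HasZeroObject C] (R : C → Prop) {X : C} (hX : IsFiniteSum P X) :
    ∃ U V, IsFiniteSum (fun W ↦ P W ∧ R W) U ∧ IsFiniteSum (fun W ↦ P W ∧ ¬ R W) V ∧
      Nonempty (X ≅ U ⊞ V) := by
  induction hX with
  | @zero X h =>
    obtain ⟨e⟩ := nonempty_iso_biprod_of_isZero (X := X) h
    exact ⟨X, X, .zero h, .zero h, ⟨e⟩⟩
  | @add X A B hA hB e ih =>
    obtain ⟨U, V, hU, hV, ⟨i⟩⟩ := ih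
    by_cases hR : R B
    · exact ⟨U ⊞ B, V, .add hU ⟨hB, hR⟩ (Iso.refl _), hV,
        ⟨e ≪≫ biprod.mapIso i (Iso.refl B) ≪≫ biprod.associator _ _ _ ≪≫
          biprod.mapIso (Iso.refl U) (biprod.braiding _ _) ≪≫ (biprod.associator _ _ _).symm⟩⟩
    · exact ⟨U, V ⊞ B, hU, .add hV ⟨hB, hR⟩ (Iso.refl _),
        ⟨e ≪≫ biprod.mapIso i (Iso.refl B) ≪≫ biprod.associator _ _ _⟩⟩

end IsFiniteSum

/-- Indecomposability only depends on the isomorphism class. -/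
lemma CategoryTheory.Indecomposable.of_iso {X Y : C} (hX : Indecomposable X) (e : X ≅ Y) :
    Indecomposable Y :=
  ⟨fun h ↦ hX.1 (h.of_iso e), fun A B e' ↦ hX.2 A B (e ≪≫ e')⟩

lemma CategoryTheory.Indecomposable.exists_iso_of_isFiniteSum {P : ObjectProperty C} {X : C}
    (hX : Indecomposable X) (h : IsFiniteSum P X) : ∃ B, P B ∧ Nonempty (X ≅ B) := by
  induction h with
  | zero h => exact (hX.1 h).elim
  | @add X A B hA hB e ih =>
    obtain h | h := hX.2 A B e
    · obtain ⟨e'⟩ := IsFiniteSum.nonempty_iso_biprod_of_isZero (X := B) h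
      exact ⟨B, hB, ⟨e ≪≫ e'.symm⟩⟩
    · obtain ⟨e'⟩ := IsFiniteSum.nonempty_iso_biprod_of_isZero' (X := A) h
      have e'' := e ≪≫ e'.symm
      obtain ⟨B', hB', ⟨f⟩⟩ := ih (Indecomposable.of_iso hX e'')
      exact ⟨B', hB', ⟨e'' ≪≫ f⟩⟩

end FiniteSums

/-! ### Functors out of the additive envelope -/

section AdditiveEnvelope

universe v₁ u₁ v₂ u₂

variable {R : Type u₁} [Category.{v₁} R] [Preadditive R]
  {C : Type u₂} [Category.{v₂} C] [Preadditive C] [HasFiniteBiproducts C]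

namespace CategoryTheory.Mat_

/-- The extension to the additive envelope of an additive functor to a category with finite
biproducts. Unlike `Mat_.lift`, the target may live in arbitrary universes. -/
noncomputable def extend (F : R ⥤ C) [F.Additive] : Mat_ R ⥤ C where
  obj M := ⨁ fun i ↦ F.obj (M.X i)
  map f := biproduct.matrix fun i j ↦ F.map (f i j)
  map_id X := by
    ext i j
    by_cases h : j = i
    · subst h; simp
    · simp [h]
  map_comp f g := by
    ext i j
    simp [biproduct.lift_desc]

instance (F : R ⥤ C) [F.Additive] : (extend F).Additive where
  map_add {M N f g} := by
    change (biproduct.matrix fun i j ↦ F.map ((f + g) i j)) =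
      (biproduct.matrix fun i j ↦ F.map (f i j)) + (biproduct.matrix fun i j ↦ F.map (g i j))
    ext i j
    simp

instance (F : R ⥤ C) [F.Additive] [F.Faithful] : (extend F).Faithful where
  map_injective {M N f g} h := by
    ext i j
    apply F.map_injective
    replace h : (biproduct.matrix fun i j ↦ F.map (f i j)) =
      (biproduct.matrix fun i j ↦ F.map (g i j)) := h
    have := congr_arg (fun t ↦ biproduct.ι _ i ≫ t ≫ biproduct.π _ j) h
    simpa using this

instance (F : R ⥤ C) [F.Additive] [F.Full] : (extend F).Full where
  map_surjective {M N} f := by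
    change (⨁ fun i ↦ F.obj (M.X i)) ⟶ (⨁ fun i ↦ F.obj (N.X i)) at f
    refine ⟨fun i j ↦ F.preimage (biproduct.ι (fun i ↦ F.obj (M.X i)) i ≫ f ≫
      biproduct.π (fun i ↦ F.obj (N.X i)) j), ?_⟩
    change (biproduct.matrix fun i j ↦ _) = f
    ext i j
    simp

/-- The extension of a functor to the additive envelope restricts to the given functor. -/
noncomputable def embeddingExtendIso (F : R ⥤ C) [F.Additive] : embedding R ⋙ extend F ≅ F :=
  NatIso.ofComponents (fun X ↦ biproductUniqueIso (fun _ : PUnit ↦ F.obj X)) (fun {X Y} f ↦ by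
    change (biproduct.matrix fun _ _ ↦ F.map f) ≫
      (biproductUniqueIso (fun _ : PUnit ↦ F.obj Y)).hom =
        (biproductUniqueIso (fun _ : PUnit ↦ F.obj X)).hom ≫ F.map f
    ext
    simp [biproduct.lift_desc, limitBiconeOfUnique])

/-- The inclusion of an entry of a tuple. -/
noncomputable def entryι (M : Mat_ R) (i : M.ι) : (embedding R).obj (M.X i) ⟶ M :=
  fun _ j ↦ (𝟙 M : M ⟶ M) i j

/-- The projection to an entry of a tuple. -/
noncomputable def entryπ (M : Mat_ R) (i : M.ι) : M ⟶ (embedding R).obj (M.X i) :=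
  fun j _ ↦ (𝟙 M : M ⟶ M) j i

lemma sum_apply {M N : Mat_ R} {J : Type*} (s : Finset J) (f : J → (M ⟶ N)) (i : M.ι)
    (j : N.ι) : (∑ a ∈ s, f a) i j = ∑ a ∈ s, f a i j := by
  classical
  induction s using Finset.induction_on with
  | empty => rfl
  | insert a s ha ih => rw [Finset.sum_insert ha, Finset.sum_insert ha, add_apply, ih]

lemma entryι_comp {M N : Mat_ R} (f : M ⟶ N) (i : M.ι) :
    M.entryι i ≫ f = ∑ j, (embedding R).map (f i j) ≫ N.entryι j := by
  ext _ k
  rw [sum_apply]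
  refine (congr_fun (congr_fun ((Category.id_comp f).trans (Category.comp_id f).symm) i) k).trans ?_
  refine Finset.sum_congr rfl fun j _ ↦ ?_
  exact (Finset.sum_singleton (fun _ : PUnit ↦ f i j ≫ (𝟙 N : N ⟶ N) j k) PUnit.unit).symm

lemma entryι_entryπ (M : Mat_ R) (i j : M.ι) :
    M.entryι i ≫ M.entryπ j = (embedding R).map ((𝟙 M : M ⟶ M) i j) := by
  ext
  exact congr_fun (congr_fun (Category.id_comp (𝟙 M)) i) j

lemma sum_entryπ_entryι (M : Mat_ R) : ∑ i, M.entryπ i ≫ M.entryι i = 𝟙 M := by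
  ext j k
  rw [sum_apply]
  change ∑ i, ∑ _ : PUnit, (𝟙 M : M ⟶ M) j i ≫ (𝟙 M : M ⟶ M) i k = _
  simp only [Finset.univ_unique, Finset.sum_singleton]
  exact congr_fun (congr_fun (Category.id_comp (𝟙 M)) j) k

section

variable {C' : Type u₂} [Category.{v₂} C'] [Preadditive C'] {F G : Mat_ R ⥤ C'}

/-- The component at a tuple of the extension of a natural transformation. -/
noncomputable def extendApp (α : embedding R ⋙ F ⟶ embedding R ⋙ G) (M : Mat_ R) :
    F.obj M ⟶ G.obj M :=
  ∑ i, F.map (M.entryπ i) ≫ α.app (M.X i) ≫ G.map (M.entryι i)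

lemma map_entryι_extendApp [F.Additive] [G.Additive] (α : embedding R ⋙ F ⟶ embedding R ⋙ G)
    (M : Mat_ R) (i : M.ι) :
    F.map (M.entryι i) ≫ extendApp α M = α.app (M.X i) ≫ G.map (M.entryι i) := by
  have h (j : M.ι) : F.map (M.entryι i) ≫ F.map (M.entryπ j) ≫ α.app (M.X j) ≫
      G.map (M.entryι j) = α.app (M.X i) ≫
        G.map ((embedding R).map ((𝟙 M : M ⟶ M) i j) ≫ M.entryι j) := by
    rw [← F.map_comp_assoc, entryι_entryπ, G.map_comp]
    exact α.naturality_assoc _ _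
  rw [extendApp, Preadditive.comp_sum, Finset.sum_congr rfl (fun j _ ↦ h j),
    ← Preadditive.comp_sum, ← G.map_sum, ← entryι_comp, Category.comp_id]

lemma hom_ext_entryι [F.Additive] {M : Mat_ R} {Z : C'} {f g : F.obj M ⟶ Z}
    (h : ∀ i, F.map (M.entryι i) ≫ f = F.map (M.entryι i) ≫ g) : f = g := by
  rw [← Category.id_comp f, ← Category.id_comp g, ← F.map_id, ← sum_entryπ_entryι, F.map_sum,
    Preadditive.sum_comp, Preadditive.sum_comp]
  refine Finset.sum_congr rfl fun i _ ↦ ?_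
  rw [F.map_comp, Category.assoc, Category.assoc, h]

/-- Additive functors on the additive envelope are isomorphic as soon as they are isomorphic on
one-by-one matrices. -/
noncomputable def isoOfEmbeddingIso [F.Additive] [G.Additive]
    (α : embedding R ⋙ F ≅ embedding R ⋙ G) : F ≅ G :=
  NatIso.ofComponents (fun M ↦
    { hom := extendApp α.hom M
      inv := extendApp α.inv M
      hom_inv_id := hom_ext_entryι fun i ↦ by
        rw [← Category.assoc, map_entryι_extendApp, Category.assoc, map_entryι_extendApp]
        simp [α.hom_inv_id_app_assoc]
      inv_hom_id := hom_ext_entryι fun i ↦ by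
        rw [← Category.assoc, map_entryι_extendApp, Category.assoc, map_entryι_extendApp]
        simp [α.inv_hom_id_app_assoc] })
    (fun {M N} f ↦ hom_ext_entryι fun i ↦ by
      dsimp
      rw [← Category.assoc, ← F.map_comp, entryι_comp, F.map_sum, Preadditive.sum_comp,
        ← Category.assoc, map_entryι_extendApp, Category.assoc, ← G.map_comp, entryι_comp,
        G.map_sum, Preadditive.comp_sum]
      refine Finset.sum_congr rfl fun j _ ↦ ?_
      rw [F.map_comp, Category.assoc, map_entryι_extendApp, G.map_comp]
      exact α.hom.naturality_assoc _ _)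

end

end CategoryTheory.Mat_

end AdditiveEnvelope

/-! ### Transporting morphisms of degree zero and one -/

section Transport

set_option linter.unusedSectionVars false

universe v₀ u₀ v₁ u₁ v₂ u₂

variable {H : Type u₀} [Category.{v₀} H] [Preadditive H]
  {C : Type u₁} [Category.{v₁} C] [Preadditive C] [HasShift C ℤ]
  [∀ n : ℤ, (shiftFunctor C n).Additive]
  {E : Type u₂} [Category.{v₂} E] [Preadditive E] [HasShift E ℤ]
  [∀ n : ℤ, (shiftFunctor E n).Additive]

/-- Two functors `S` and `T` from an additive category to categories with shift have the same
extensions if the groups `Hom(S X, (S Y)⟦1⟧)` and `Hom(T X, (T Y)⟦1⟧)` are identified, naturally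
in `X` and `Y`. -/
structure ExtComparison (S : H ⥤ C) (T : H ⥤ E) where
  /-- the identification of the groups of extensions -/
  equiv (X Y : H) : (S.obj X ⟶ (S.obj Y)⟦(1 : ℤ)⟧) ≃+ (T.obj X ⟶ (T.obj Y)⟦(1 : ℤ)⟧)
  map_comp_left {X X' Y : H} (f : X' ⟶ X) (e : S.obj X ⟶ (S.obj Y)⟦(1 : ℤ)⟧) :
    equiv X' Y (S.map f ≫ e) = T.map f ≫ equiv X Y e
  map_comp_right {X Y Y' : H} (e : S.obj X ⟶ (S.obj Y)⟦(1 : ℤ)⟧) (g : Y ⟶ Y') :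
    equiv X Y' (e ≫ (S.map g)⟦(1 : ℤ)⟧') = equiv X Y e ≫ (T.map g)⟦(1 : ℤ)⟧'

/-- The morphisms between the shifts of the objects in the image of `S` are all of degree `0` or
`1`. -/
def IsHereditaryImage (S : H ⥤ C) : Prop :=
  ∀ (X Y : H) (n : ℤ) (f : S.obj X ⟶ (S.obj Y)⟦n⟧), n ≠ 0 → n ≠ 1 → f = 0

/-- The morphism `(S X)⟦m⟧ ⟶ (S Y)⟦n⟧` with `m + 1 = n` defined by a morphism `S X ⟶ (S Y)⟦1⟧`. -/
def degreeOne (S : H ⥤ C) {X Y : H} (m n : ℤ) (h : 1 + m = n) (e : S.obj X ⟶ (S.obj Y)⟦(1 : ℤ)⟧) :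
    (S.obj X)⟦m⟧ ⟶ (S.obj Y)⟦n⟧ :=
  e⟦m⟧' ≫ (shiftFunctorAdd' C 1 m n h).inv.app (S.obj Y)

section

variable (S : H ⥤ C)

lemma degreeOne_add {X Y : H} (m n : ℤ) (h : 1 + m = n) (e e' : S.obj X ⟶ (S.obj Y)⟦(1 : ℤ)⟧) :
    degreeOne S m n h (e + e') = degreeOne S m n h e + degreeOne S m n h e' := by
  simp [degreeOne, Functor.map_add]

lemma map_comp_degreeOne {X X' Y : H} (m n : ℤ) (h : 1 + m = n) (f : X' ⟶ X)
    (e : S.obj X ⟶ (S.obj Y)⟦(1 : ℤ)⟧) :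
    (S.map f)⟦m⟧' ≫ degreeOne S m n h e = degreeOne S m n h (S.map f ≫ e) := by
  simp [degreeOne]

lemma degreeOne_comp_map {X Y Y' : H} (m n : ℤ) (h : 1 + m = n)
    (e : S.obj X ⟶ (S.obj Y)⟦(1 : ℤ)⟧) (g : Y ⟶ Y') :
    degreeOne S m n h e ≫ (S.map g)⟦n⟧' = degreeOne S m n h (e ≫ (S.map g)⟦(1 : ℤ)⟧') := by
  simp only [degreeOne, Category.assoc, Functor.map_comp]
  congr 1
  exact ((shiftFunctorAdd' C 1 m n h).inv.naturality (S.map g)).symm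

lemma degreeOne_bijective {X Y : H} (m n : ℤ) (h : 1 + m = n) :
    Function.Bijective (degreeOne S m n h (X := X) (Y := Y)) := by
  refine ⟨fun e e' he ↦ ?_, fun f ↦ ?_⟩
  · apply (shiftFunctor C m).map_injective
    rwa [degreeOne, degreeOne, cancel_mono] at he
  · obtain ⟨e, he⟩ := (shiftFunctor C m).map_surjective
      (f ≫ (shiftFunctorAdd' C 1 m n h).hom.app (S.obj Y))
    exact ⟨e, by rw [degreeOne, he, Category.assoc, Iso.hom_inv_id_app, Category.comp_id]⟩

lemma degreeOne_shift {X Y : H} (m n m' n' : ℤ) (h : 1 + m = n) (hm : m + 1 = m')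
    (hn : n + 1 = n') (e : S.obj X ⟶ (S.obj Y)⟦(1 : ℤ)⟧) :
    (degreeOne S m n h e)⟦(1 : ℤ)⟧' ≫ (shiftFunctorAdd' C n 1 n' hn).inv.app (S.obj Y) =
      (shiftFunctorAdd' C m 1 m' hm).inv.app (S.obj X) ≫ degreeOne S m' n' (by lia) e := by
  rw [degreeOne, degreeOne, Functor.map_comp, Category.assoc,
    shiftFunctorAdd'_assoc_inv_app 1 m 1 n m' n' h hm (by lia), ← Category.assoc, ← Category.assoc]
  congr 1
  exact (shiftFunctorAdd' C m 1 m' hm).inv.naturality e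

lemma map_shift {X Y : H} (m m' : ℤ) (hm : m + 1 = m') (f : X ⟶ Y) :
    ((S.map f)⟦m⟧')⟦(1 : ℤ)⟧' ≫ (shiftFunctorAdd' C m 1 m' hm).inv.app (S.obj Y) =
      (shiftFunctorAdd' C m 1 m' hm).inv.app (S.obj X) ≫ (S.map f)⟦m'⟧' :=
  (shiftFunctorAdd' C m 1 m' hm).inv.naturality (S.map f)

variable {S}

lemma IsHereditaryImage.eq_zero (hS : IsHereditaryImage S) {X Y : H} {m n : ℤ}
    (f : (S.obj X)⟦m⟧ ⟶ (S.obj Y)⟦n⟧) (h₀ : n ≠ m) (h₁ : 1 + m ≠ n) : f = 0 := by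
  obtain ⟨g, hg⟩ := (shiftFunctor C m).map_surjective
    (f ≫ (shiftFunctorAdd' C (n - m) m n (by lia)).hom.app (S.obj Y))
  rw [hS X Y _ g (by lia) (by lia), Functor.map_zero] at hg
  rw [← cancel_mono ((shiftFunctorAdd' C (n - m) m n (by lia)).hom.app (S.obj Y)), ← hg, zero_comp]

/-- Case distinction on the degree of a morphism between shifts of objects in the image of `S`. -/
lemma IsHereditaryImage.cases (hS : IsHereditaryImage S) [S.Full] {X Y : H}
    {P : ∀ m n : ℤ, ((S.obj X)⟦m⟧ ⟶ (S.obj Y)⟦n⟧) → Prop}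
    (h₀ : ∀ (m : ℤ) (f : X ⟶ Y), P m m ((S.map f)⟦m⟧'))
    (h₁ : ∀ (m n : ℤ) (h : 1 + m = n) (e : S.obj X ⟶ (S.obj Y)⟦(1 : ℤ)⟧),
      P m n (degreeOne S m n h e))
    (hz : ∀ m n : ℤ, n ≠ m → 1 + m ≠ n → P m n 0) {m n : ℤ} (f : (S.obj X)⟦m⟧ ⟶ (S.obj Y)⟦n⟧) :
    P m n f := by
  by_cases h : n = m
  · subst h
    obtain ⟨g, rfl⟩ := (S ⋙ shiftFunctor C n).map_surjective f
    exact h₀ n g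
  · by_cases h' : 1 + m = n
    · obtain ⟨e, rfl⟩ := (degreeOne_bijective S m n h').2 f
      exact h₁ m n h' e
    · rw [hS.eq_zero f h h']
      exact hz m n h h'

end

namespace ExtComparison

variable {S : H ⥤ C} {T : H ⥤ E} (θ : ExtComparison S T)
  [S.Full] [S.Faithful] [S.Additive] [T.Full] [T.Faithful] [T.Additive]

/-- The map from morphisms between shifts of objects in the image of `S` to those in the image
of `T`, defined in degree `0` by the full faithfulness of `S`, in degree `1` by the comparison of
extensions, and by zero in the other degrees. -/
noncomputable def mapHom {X Y : H} (m n : ℤ) (f : (S.obj X)⟦m⟧ ⟶ (S.obj Y)⟦n⟧) :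
    (T.obj X)⟦m⟧ ⟶ (T.obj Y)⟦n⟧ :=
  if h : n = m then
    (T.map ((S ⋙ shiftFunctor C m).preimage (f ≫ eqToHom (by rw [h]; rfl))))⟦m⟧' ≫
      eqToHom (by rw [h])
  else if h : 1 + m = n then
    degreeOne T m n h (θ.equiv X Y ((Equiv.ofBijective _ (degreeOne_bijective S m n h)).symm f))
  else 0

@[simp]
lemma mapHom_map {X Y : H} (m : ℤ) (f : X ⟶ Y) :
    θ.mapHom m m ((S.map f)⟦m⟧') = (T.map f)⟦m⟧' := by
  have : (S ⋙ shiftFunctor C m).preimage ((S.map f)⟦m⟧') = f :=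
    (S ⋙ shiftFunctor C m).map_injective (Functor.map_preimage _ _)
  simp [mapHom, this]

@[simp]
lemma mapHom_degreeOne {X Y : H} (m n : ℤ) (h : 1 + m = n) (e : S.obj X ⟶ (S.obj Y)⟦(1 : ℤ)⟧) :
    θ.mapHom m n (degreeOne S m n h e) = degreeOne T m n h (θ.equiv X Y e) := by
  rw [mapHom, dif_neg (by lia), dif_pos h]
  congr 2
  exact (Equiv.ofBijective _ (degreeOne_bijective S m n h)).symm_apply_apply e

lemma mapHom_of_ne {X Y : H} (m n : ℤ) (h₀ : n ≠ m) (h₁ : 1 + m ≠ n)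
    (f : (S.obj X)⟦m⟧ ⟶ (S.obj Y)⟦n⟧) : θ.mapHom m n f = 0 := by
  rw [mapHom, dif_neg h₀, dif_neg h₁]

lemma mapHom_bijective (hS : IsHereditaryImage S) (hT : IsHereditaryImage T) {X Y : H} (m n : ℤ) :
    Function.Bijective (θ.mapHom m n (X := X) (Y := Y)) := by
  by_cases h : n = m
  · subst h
    refine ⟨fun f g hfg ↦ ?_, fun f ↦ ?_⟩
    · obtain ⟨f, rfl⟩ := (S ⋙ shiftFunctor C n).map_surjective f
      obtain ⟨g, rfl⟩ := (S ⋙ shiftFunctor C n).map_surjective g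
      simp only [Functor.comp_map, mapHom_map] at hfg ⊢
      rw [(T ⋙ shiftFunctor E n).map_injective hfg]
    · obtain ⟨f, rfl⟩ := (T ⋙ shiftFunctor E n).map_surjective f
      exact ⟨(S.map f)⟦n⟧', θ.mapHom_map n f⟩
  · by_cases h' : 1 + m = n
    · refine ⟨fun f g hfg ↦ ?_, fun f ↦ ?_⟩
      · obtain ⟨f, rfl⟩ := (degreeOne_bijective S m n h').2 f
        obtain ⟨g, rfl⟩ := (degreeOne_bijective S m n h').2 g
        rw [mapHom_degreeOne, mapHom_degreeOne] at hfg
        rw [(θ.equiv X Y).injective ((degreeOne_bijective T m n h').1 hfg)]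
      · obtain ⟨f, rfl⟩ := (degreeOne_bijective T m n h').2 f
        exact ⟨degreeOne S m n h' ((θ.equiv X Y).symm f), by simp⟩
    · exact ⟨fun f g _ ↦ by rw [hS.eq_zero f h h', hS.eq_zero g h h'],
        fun f ↦ ⟨0, by rw [hT.eq_zero f h h', θ.mapHom_of_ne m n h h']⟩⟩

lemma mapHom_add {X Y : H} (m n : ℤ) (f g : (S.obj X)⟦m⟧ ⟶ (S.obj Y)⟦n⟧) :
    θ.mapHom m n (f + g) = θ.mapHom m n f + θ.mapHom m n g := by
  by_cases h : n = m
  · subst h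
    obtain ⟨f, rfl⟩ := (S ⋙ shiftFunctor C n).map_surjective f
    obtain ⟨g, rfl⟩ := (S ⋙ shiftFunctor C n).map_surjective g
    simp only [Functor.comp_map, ← Functor.map_add, mapHom_map]
  · by_cases h' : 1 + m = n
    · obtain ⟨f, rfl⟩ := (degreeOne_bijective S m n h').2 f
      obtain ⟨g, rfl⟩ := (degreeOne_bijective S m n h').2 g
      simp only [← degreeOne_add, mapHom_degreeOne, map_add]
    · simp [θ.mapHom_of_ne m n h h']

/-- Compositions of two morphisms of degree one vanish on both sides, so that the comparison
of extensions only has to be compatible with the morphisms of degree zero. -/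
lemma mapHom_comp (hS : IsHereditaryImage S) (hT : IsHereditaryImage T) {X Y Z : H} {m n p : ℤ}
    (f : (S.obj X)⟦m⟧ ⟶ (S.obj Y)⟦n⟧) (g : (S.obj Y)⟦n⟧ ⟶ (S.obj Z)⟦p⟧) :
    θ.mapHom m p (f ≫ g) = θ.mapHom m n f ≫ θ.mapHom n p g := by
  have hzero (m n : ℤ) (X Y : H) : θ.mapHom m n (0 : (S.obj X)⟦m⟧ ⟶ (S.obj Y)⟦n⟧) = 0 := by
    have := θ.mapHom_add m n (0 : (S.obj X)⟦m⟧ ⟶ (S.obj Y)⟦n⟧) 0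
    simpa using this
  revert g
  refine hS.cases (P := fun m n f ↦ ∀ g, θ.mapHom m p (f ≫ g) = θ.mapHom m n f ≫ θ.mapHom n p g)
    ?_ ?_ ?_ f
  · intro m f g
    refine hS.cases (P := fun m p g ↦ ∀ f : X ⟶ Y, θ.mapHom m p ((S.map f)⟦m⟧' ≫ g) =
      θ.mapHom m m ((S.map f)⟦m⟧') ≫ θ.mapHom m p g) ?_ ?_ ?_ g f
    · intro m g f
      rw [← Functor.map_comp, ← Functor.map_comp, mapHom_map, mapHom_map, mapHom_map,
        ← Functor.map_comp, ← Functor.map_comp]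
    · intro m n h e f
      rw [map_comp_degreeOne, mapHom_degreeOne, mapHom_map, mapHom_degreeOne, map_comp_degreeOne,
        θ.map_comp_left]
    · intro m n _ _ f
      simp [hzero]
  · intro m n h e g
    refine hS.cases (P := fun n p g ↦ ∀ h : 1 + m = n, θ.mapHom m p (degreeOne S m n h e ≫ g) =
      θ.mapHom m n (degreeOne S m n h e) ≫ θ.mapHom n p g) ?_ ?_ ?_ g h
    · intro n g h
      rw [degreeOne_comp_map, mapHom_degreeOne, mapHom_map, mapHom_degreeOne, degreeOne_comp_map,
        θ.map_comp_right]
    · intro n p h' e' h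
      rw [θ.mapHom_of_ne m p (by lia) (by lia)]
      exact (hT.eq_zero _ (by lia) (by lia)).symm
    · intro m n _ _ f
      simp [hzero]
  · intro m n _ _ g
    simp [hzero]

lemma mapHom_shift (hS : IsHereditaryImage S) {X Y : H} (m n m' n' : ℤ) (hm : m + 1 = m')
    (hn : n + 1 = n') (f : (S.obj X)⟦m⟧ ⟶ (S.obj Y)⟦n⟧) :
    (θ.mapHom m n f)⟦(1 : ℤ)⟧' ≫ (shiftFunctorAdd' E n 1 n' hn).inv.app (T.obj Y) =
      (shiftFunctorAdd' E m 1 m' hm).inv.app (T.obj X) ≫ θ.mapHom m' n'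
        ((shiftFunctorAdd' C m 1 m' hm).hom.app (S.obj X) ≫ f⟦(1 : ℤ)⟧' ≫
          (shiftFunctorAdd' C n 1 n' hn).inv.app (S.obj Y)) := by
  revert m' n'
  refine hS.cases (P := fun m n f ↦ ∀ m' n' (hm : m + 1 = m') (hn : n + 1 = n'),
    (θ.mapHom m n f)⟦(1 : ℤ)⟧' ≫ (shiftFunctorAdd' E n 1 n' hn).inv.app (T.obj Y) =
      (shiftFunctorAdd' E m 1 m' hm).inv.app (T.obj X) ≫ θ.mapHom m' n'
        ((shiftFunctorAdd' C m 1 m' hm).hom.app (S.obj X) ≫ f⟦(1 : ℤ)⟧' ≫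
          (shiftFunctorAdd' C n 1 n' hn).inv.app (S.obj Y))) ?_ ?_ ?_ f
  · intro m f m' n' hm hn
    obtain rfl : m' = n' := by lia
    rw [map_shift, mapHom_map, map_shift, Iso.hom_inv_id_app_assoc, mapHom_map]
  · intro m n h e m' n' hm hn
    rw [degreeOne_shift S m n m' n' h hm hn, mapHom_degreeOne, degreeOne_shift T m n m' n' h hm hn,
      Iso.hom_inv_id_app_assoc, mapHom_degreeOne]
  · intro m n h h' m' n' hm hn
    rw [θ.mapHom_of_ne m n h h', θ.mapHom_of_ne m' n' (by lia) (by lia)]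
    simp

end ExtComparison

/-! ### Extending the comparison to finite direct sums of shifts -/

/-- The full subcategory of `C` on the shifts of the objects in the image of `S`, its objects being
indexed by an object of `H` and a degree. -/
abbrev ShiftedImage (S : H ⥤ C) : Type u₀ :=
  InducedCategory C (fun p : H × ℤ ↦ (S.obj p.1)⟦p.2⟧)

variable (S : H ⥤ C)

/-- The inclusion of the category of shifts of the objects in the image of `S`. -/
abbrev ShiftedImage.incl : ShiftedImage S ⥤ C := inducedFunctor _

/-- The shift by one on the category of shifts of the objects in the image of `S`. -/
noncomputable def ShiftedImage.shift : ShiftedImage S ⥤ ShiftedImage S where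
  obj p := (p.1, p.2 + 1)
  map {p q} f := InducedCategory.homMk
    ((shiftFunctorAdd' C p.2 1 (p.2 + 1) rfl).hom.app (S.obj p.1) ≫ f.hom⟦(1 : ℤ)⟧' ≫
      (shiftFunctorAdd' C q.2 1 (q.2 + 1) rfl).inv.app (S.obj q.1))
  map_id p := by
    ext
    simp
  map_comp f g := by
    ext
    simp

section

variable {S}
variable {T : H ⥤ E} (θ : ExtComparison S T)
  [S.Full] [S.Faithful] [S.Additive] [T.Full] [T.Faithful] [T.Additive]

/-- The functor which sends `(S X)⟦n⟧` to `(T X)⟦n⟧` defined by a comparison of extensions. -/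
noncomputable def ExtComparison.functor (hS : IsHereditaryImage S) (hT : IsHereditaryImage T) :
    ShiftedImage S ⥤ E where
  obj p := (T.obj p.1)⟦p.2⟧
  map {p q} f := θ.mapHom p.2 q.2 f.hom
  map_id p := by
    have := θ.mapHom_map p.2 (𝟙 p.1)
    simpa using this
  map_comp f g := θ.mapHom_comp hS hT f.hom g.hom

namespace ExtComparison

variable (hS : IsHereditaryImage S) (hT : IsHereditaryImage T)

instance : (θ.functor hS hT).Additive where
  map_add := θ.mapHom_add _ _ _ _

instance : (θ.functor hS hT).Faithful where
  map_injective h := InducedCategory.hom_ext ((θ.mapHom_bijective hS hT _ _).1 h)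

instance : (θ.functor hS hT).Full where
  map_surjective f := by
    obtain ⟨g, hg⟩ := (θ.mapHom_bijective hS hT _ _).2 f
    exact ⟨InducedCategory.homMk g, hg⟩

instance : (ShiftedImage.shift S).Additive where
  map_add {p q f g} := by
    ext
    change _ ≫ (f.hom + g.hom)⟦(1 : ℤ)⟧' ≫ _ = _ ≫ f.hom⟦(1 : ℤ)⟧' ≫ _ + _ ≫ g.hom⟦(1 : ℤ)⟧' ≫ _
    simp only [Functor.map_add, Preadditive.add_comp, Preadditive.comp_add]
    rfl

variable (S) in
/-- The inclusion of the category of shifts commutes with the shift by one. -/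
noncomputable def inclShiftIso :
    ShiftedImage.incl S ⋙ shiftFunctor C (1 : ℤ) ≅ ShiftedImage.shift S ⋙ ShiftedImage.incl S :=
  NatIso.ofComponents
    (fun p ↦ ((shiftFunctorAdd' C p.2 1 (p.2 + 1) rfl).app (S.obj p.1)).symm)
    (fun {p q} f ↦ by simp [ShiftedImage.shift])

/-- The functor `ExtComparison.functor` commutes with the shift by one. -/
noncomputable def functorShiftIso :
    θ.functor hS hT ⋙ shiftFunctor E (1 : ℤ) ≅ ShiftedImage.shift S ⋙ θ.functor hS hT :=
  NatIso.ofComponents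
    (fun p ↦ ((shiftFunctorAdd' E p.2 1 (p.2 + 1) rfl).app (T.obj p.1)).symm)
    (fun {p q} f ↦ θ.mapHom_shift hS p.2 q.2 (p.2 + 1) (q.2 + 1) rfl rfl f.hom)

/-- If a functor on the shifts of the image of `S` commutes with the shift by one, so does its
extension to the additive envelope. -/
noncomputable def extendShiftIso {F : Type*} [Category* F] [Preadditive F] [HasFiniteBiproducts F]
    [HasShift F ℤ] [∀ n : ℤ, (shiftFunctor F n).Additive]
    (G : ShiftedImage S ⥤ F) [G.Additive]
    (α : G ⋙ shiftFunctor F (1 : ℤ) ≅ ShiftedImage.shift S ⋙ G) :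
    Mat_.extend G ⋙ shiftFunctor F (1 : ℤ) ≅
      Mat_.extend (ShiftedImage.shift S ⋙ Mat_.embedding _) ⋙ Mat_.extend G :=
  Mat_.isoOfEmbeddingIso
    ((Functor.associator _ _ _).symm ≪≫
      Functor.isoWhiskerRight (Mat_.embeddingExtendIso G) _ ≪≫ α ≪≫
      Functor.isoWhiskerLeft _ (Mat_.embeddingExtendIso G).symm ≪≫
      (Functor.associator _ _ _).symm ≪≫
      Functor.isoWhiskerRight (Mat_.embeddingExtendIso _).symm _ ≪≫
      Functor.associator _ _ _)

/-- If all the objects of `C` are finite direct sums of shifts of objects in the image of `S`, a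
comparison of extensions between `S` and `T` extends to a fully faithful functor which commutes
with the shift by one. -/
theorem exists_functor (θ : ExtComparison S T) [HasBinaryBiproducts C] [HasFiniteBiproducts C]
    [HasFiniteBiproducts E]
    (hS : IsHereditaryImage S) (hT : IsHereditaryImage T)
    (h : ∀ Z : C, IsFiniteSum (fun W ↦ ∃ (X : H) (n : ℤ), Nonempty (W ≅ (S.obj X)⟦n⟧)) Z) :
    ∃ Ψ : C ⥤ E, Ψ.Full ∧ Ψ.Faithful ∧ Ψ.Additive ∧
      (∀ (X : H) (n : ℤ), Nonempty (Ψ.obj ((S.obj X)⟦n⟧) ≅ (T.obj X)⟦n⟧)) ∧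
      Nonempty (shiftFunctor C (1 : ℤ) ⋙ Ψ ≅ Ψ ⋙ shiftFunctor E (1 : ℤ)) := by
  let K := Mat_.extend (ShiftedImage.incl S)
  let L := Mat_.extend (θ.functor hS hT)
  let M := Mat_.extend (ShiftedImage.shift S ⋙ Mat_.embedding _)
  have := hasBinaryBiproducts_of_finite_biproducts (Mat_ (ShiftedImage S))
  obtain ⟨O, hO⟩ := (hasZeroObject_of_hasFiniteBiproducts (Mat_ (ShiftedImage S))).zero
  have : K.Additive := inferInstanceAs (Mat_.extend _).Additive
  have : L.Additive := inferInstanceAs (Mat_.extend _).Additive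
  have := preservesBinaryBiproducts_of_preservesBiproducts K
  have : K.EssSurj := ⟨fun Z ↦ (h Z).le_of_closed (Q := K.essImage)
    (fun X hX ↦ ⟨O, ⟨(K.map_isZero hO).iso hX⟩⟩)
    (fun X Y ⟨X', ⟨e⟩⟩ ⟨Y', ⟨e'⟩⟩ ↦ ⟨X' ⊞ Y', ⟨K.mapBiprod X' Y' ≪≫ biprod.mapIso e e'⟩⟩)
    (fun X ⟨Y, n, ⟨e⟩⟩ ↦ ⟨(Mat_.embedding _).obj (Y, n),
      ⟨(Mat_.embeddingExtendIso (ShiftedImage.incl S)).app (Y, n) ≪≫ e.symm⟩⟩)⟩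
  have : K.IsEquivalence := { }
  have : K.asEquivalence.functor.Additive := ‹K.Additive›
  have : K.inv.Additive := K.asEquivalence.inverse_additive
  refine ⟨K.inv ⋙ L, inferInstance, inferInstance, inferInstance, fun X n ↦ ?_, ⟨?_⟩⟩
  · exact ⟨L.mapIso (K.inv.mapIso
      ((Mat_.embeddingExtendIso (ShiftedImage.incl S)).app (X, n)).symm ≪≫
        K.asEquivalence.unitIso.symm.app _) ≪≫
      (Mat_.embeddingExtendIso (θ.functor hS hT)).app (X, n)⟩
  · have a : K ⋙ shiftFunctor C (1 : ℤ) ≅ M ⋙ K := extendShiftIso _ (inclShiftIso S)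
    have b : L ⋙ shiftFunctor E (1 : ℤ) ≅ M ⋙ L := extendShiftIso _ (θ.functorShiftIso hS hT)
    let η : K ⋙ K.inv ≅ 𝟭 _ := K.asEquivalence.unitIso.symm
    let ε : K.inv ⋙ K ≅ 𝟭 _ := K.asEquivalence.counitIso
    exact (Functor.leftUnitor _).symm ≪≫
      Functor.isoWhiskerRight ε.symm (shiftFunctor C (1 : ℤ) ⋙ K.inv ⋙ L) ≪≫
      Functor.isoWhiskerLeft K.inv (Functor.isoWhiskerRight a (K.inv ⋙ L)) ≪≫
      Functor.isoWhiskerLeft (K.inv ⋙ M) (Functor.isoWhiskerRight η L) ≪≫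
      Functor.isoWhiskerLeft K.inv b.symm

end ExtComparison

end

end Transport

/-! ### Comparing extensions through short exact sequences -/

section ShortExactTriangles

set_option linter.unusedSectionVars false

universe v₀ u₀ v₁ u₁ v₂ u₂

open Pretriangulated Triangulated

variable {H : Type u₀} [Category.{v₀} H] [Abelian H]
  {C : Type u₁} [Category.{v₁} C] [Preadditive C] [HasZeroObject C] [HasShift C ℤ]
  [∀ n : ℤ, (shiftFunctor C n).Additive] [Pretriangulated C]
  {E : Type u₂} [Category.{v₂} E] [Preadditive E] [HasZeroObject E] [HasShift E ℤ]
  [∀ n : ℤ, (shiftFunctor E n).Additive] [Pretriangulated E]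

/-- A functor `S` from an abelian category to a triangulated category behaves like the inclusion
of the heart of a t-structure: there are no morphisms of negative degree, the extensions of objects
in the image are in the image, and short exact sequences are completed to distinguished
triangles. -/
structure IsHeartEmbedding (S : H ⥤ C) : Prop where
  hom_neg ⦃X Y : H⦄ ⦃n : ℤ⦄ (f : S.obj X ⟶ (S.obj Y)⟦n⟧) : n < 0 → f = 0
  exists_extension ⦃X Y : H⦄ (e : S.obj X ⟶ (S.obj Y)⟦(1 : ℤ)⟧) :
    ∃ (Z : H) (f : Y ⟶ Z) (g : Z ⟶ X), Triangle.mk (S.map f) (S.map g) e ∈ distTriang C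
  exists_triangle ⦃K : ShortComplex H⦄ (hK : K.ShortExact) :
    ∃ e, Triangle.mk (S.map K.f) (S.map K.g) e ∈ distTriang C

namespace IsHeartEmbedding

section

variable {S : H ⥤ C} [S.Full] [S.Faithful] [S.Additive] (hS : IsHeartEmbedding S)
include hS

lemma exists_shortExact {X Y Z : H} {f : Y ⟶ Z} {g : Z ⟶ X}
    {e : S.obj X ⟶ (S.obj Y)⟦(1 : ℤ)⟧} (h : Triangle.mk (S.map f) (S.map g) e ∈ distTriang C) :
    ∃ w : f ≫ g = 0, (ShortComplex.mk f g w).ShortExact := by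
  have hker := AbelianSubcategory.isLimitKernelForkOfDistTriang hS.hom_neg f g e h
  have hcoker := AbelianSubcategory.isColimitCokernelCoforkOfDistTriang hS.hom_neg f g e h
  have w : f ≫ g = 0 := S.map_injective
    (((S.map_comp _ _).trans (comp_distTriang_mor_zero₁₂ _ h)).trans (S.map_zero _ _).symm)
  exact ⟨w, ShortComplex.ShortExact.mk' (ShortComplex.exact_of_f_is_kernel (.mk f g w) hker)
    (Fork.IsLimit.mono hker) (Cofork.IsColimit.epi hcoker)⟩

/-- The compatibility of the classes of two extensions with morphisms `b` and `a` can be read on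
the underlying short exact sequences. -/
lemma comp_map_eq_map_comp_iff {X₁ Y₁ Z₁ X₂ Y₂ Z₂ : H} {f₁ : Y₁ ⟶ Z₁} {g₁ : Z₁ ⟶ X₁}
    {e₁ : S.obj X₁ ⟶ (S.obj Y₁)⟦(1 : ℤ)⟧} {f₂ : Y₂ ⟶ Z₂} {g₂ : Z₂ ⟶ X₂}
    {e₂ : S.obj X₂ ⟶ (S.obj Y₂)⟦(1 : ℤ)⟧}
    (h₁ : Triangle.mk (S.map f₁) (S.map g₁) e₁ ∈ distTriang C)
    (h₂ : Triangle.mk (S.map f₂) (S.map g₂) e₂ ∈ distTriang C) (b : Y₁ ⟶ Y₂) (a : X₁ ⟶ X₂) :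
    e₁ ≫ (S.map b)⟦(1 : ℤ)⟧' = S.map a ≫ e₂ ↔
      ∃ c : Z₁ ⟶ Z₂, f₁ ≫ c = b ≫ f₂ ∧ g₁ ≫ a = c ≫ g₂ := by
  constructor
  · intro h
    obtain ⟨c, hc₁, hc₂⟩ := complete_distinguished_triangle_morphism₂ _ _ h₁ h₂ (S.map b)
      (S.map a) h
    obtain ⟨c, rfl⟩ := S.map_surjective c
    exact ⟨c, S.map_injective (((S.map_comp _ _).trans hc₁).trans (S.map_comp _ _).symm),
      S.map_injective (((S.map_comp _ _).trans hc₂).trans (S.map_comp _ _).symm)⟩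
  · rintro ⟨c, hc₁, hc₂⟩
    obtain ⟨a', ha₁, ha₂⟩ := complete_distinguished_triangle_morphism _ _ h₁ h₂ (S.map b)
      (S.map c)
      (((S.map_comp _ _).symm.trans (S.congr_map hc₁)).trans (S.map_comp _ _))
    obtain ⟨a', rfl⟩ := S.map_surjective a'
    obtain ⟨w, hw⟩ := hS.exists_shortExact h₁
    have : Epi g₁ := hw.epi_g
    obtain rfl : a' = a := by
      rw [← cancel_epi g₁, hc₂]
      exact S.map_injective (((S.map_comp _ _).trans ha₁).trans (S.map_comp _ _).symm)
    exact ha₂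

end

/-- The classes `e` and `e'` are defined by a common short exact sequence. -/
def SameExtension (S : H ⥤ C) (T : H ⥤ E) {X Y : H} (e : S.obj X ⟶ (S.obj Y)⟦(1 : ℤ)⟧)
    (e' : T.obj X ⟶ (T.obj Y)⟦(1 : ℤ)⟧) : Prop :=
  ∃ (Z : H) (f : Y ⟶ Z) (g : Z ⟶ X), Triangle.mk (S.map f) (S.map g) e ∈ distTriang C ∧
    Triangle.mk (T.map f) (T.map g) e' ∈ distTriang E

variable {S : H ⥤ C} {T : H ⥤ E} [S.Full] [S.Faithful] [S.Additive] [T.Full] [T.Faithful]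
  [T.Additive]

lemma SameExtension.symm {X Y : H} {e : S.obj X ⟶ (S.obj Y)⟦(1 : ℤ)⟧}
    {e' : T.obj X ⟶ (T.obj Y)⟦(1 : ℤ)⟧} (h : SameExtension S T e e') : SameExtension T S e' e := by
  obtain ⟨Z, f, g, h₁, h₂⟩ := h
  exact ⟨Z, f, g, h₂, h₁⟩

lemma exists_sameExtension (hS : IsHeartEmbedding S) (hT : IsHeartEmbedding T) {X Y : H}
    (e : S.obj X ⟶ (S.obj Y)⟦(1 : ℤ)⟧) : ∃ e', SameExtension S T e e' := by
  obtain ⟨Z, f, g, h⟩ := hS.exists_extension e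
  obtain ⟨w, hw⟩ := hS.exists_shortExact h
  obtain ⟨e', h'⟩ := hT.exists_triangle hw
  exact ⟨e', Z, f, g, h, h'⟩

lemma SameExtension.comp_map_eq_map_comp (hS : IsHeartEmbedding S) (hT : IsHeartEmbedding T)
    {X₁ Y₁ X₂ Y₂ : H} {e₁ : S.obj X₁ ⟶ (S.obj Y₁)⟦(1 : ℤ)⟧} {e₁' : T.obj X₁ ⟶ (T.obj Y₁)⟦(1 : ℤ)⟧}
    {e₂ : S.obj X₂ ⟶ (S.obj Y₂)⟦(1 : ℤ)⟧} {e₂' : T.obj X₂ ⟶ (T.obj Y₂)⟦(1 : ℤ)⟧}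
    (h₁ : SameExtension S T e₁ e₁') (h₂ : SameExtension S T e₂ e₂') (b : Y₁ ⟶ Y₂) (a : X₁ ⟶ X₂)
    (h : e₁ ≫ (S.map b)⟦(1 : ℤ)⟧' = S.map a ≫ e₂) :
    e₁' ≫ (T.map b)⟦(1 : ℤ)⟧' = T.map a ≫ e₂' := by
  obtain ⟨Z₁, f₁, g₁, h₁, h₁'⟩ := h₁
  obtain ⟨Z₂, f₂, g₂, h₂, h₂'⟩ := h₂
  rwa [hT.comp_map_eq_map_comp_iff h₁' h₂', ← hS.comp_map_eq_map_comp_iff h₁ h₂]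

lemma SameExtension.eq (hS : IsHeartEmbedding S) (hT : IsHeartEmbedding T) {X Y : H}
    {e : S.obj X ⟶ (S.obj Y)⟦(1 : ℤ)⟧} {e₁ e₂ : T.obj X ⟶ (T.obj Y)⟦(1 : ℤ)⟧}
    (h₁ : SameExtension S T e e₁) (h₂ : SameExtension S T e e₂) : e₁ = e₂ := by
  simpa using h₁.comp_map_eq_map_comp hS hT h₂ (𝟙 Y) (𝟙 X) (by simp)

/-- The identification of the groups of extensions of an abelian category embedded as a heart in
two triangulated categories. -/
noncomputable def extComparison (hS : IsHeartEmbedding S) (hT : IsHeartEmbedding T) :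
    ExtComparison S T := by
  let θ {X Y : H} (e : S.obj X ⟶ (S.obj Y)⟦(1 : ℤ)⟧) : T.obj X ⟶ (T.obj Y)⟦(1 : ℤ)⟧ :=
    (hS.exists_sameExtension hT e).choose
  let θ' {X Y : H} (e : T.obj X ⟶ (T.obj Y)⟦(1 : ℤ)⟧) : S.obj X ⟶ (S.obj Y)⟦(1 : ℤ)⟧ :=
    (hT.exists_sameExtension hS e).choose
  have hθ {X Y : H} (e : S.obj X ⟶ (S.obj Y)⟦(1 : ℤ)⟧) : SameExtension S T e (θ e) :=
    (hS.exists_sameExtension hT e).choose_spec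
  have hθ' {X Y : H} (e : T.obj X ⟶ (T.obj Y)⟦(1 : ℤ)⟧) : SameExtension T S e (θ' e) :=
    (hT.exists_sameExtension hS e).choose_spec
  have hleft {X X' Y : H} (f : X' ⟶ X) (e : S.obj X ⟶ (S.obj Y)⟦(1 : ℤ)⟧) :
      θ (S.map f ≫ e) = T.map f ≫ θ e := by
    simpa using (hθ (S.map f ≫ e)).comp_map_eq_map_comp hS hT (hθ e) (𝟙 Y) f (by simp)
  -- Additivity follows from naturality: `e + e'` is the restriction to the diagonal of `X` of
  -- the morphism on `X ⊞ X` with components `e` and `e'`.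
  have hadd {X Y : H} (e e' : S.obj X ⟶ (S.obj Y)⟦(1 : ℤ)⟧) : θ (e + e') = θ e + θ e' := by
    let d := S.map (biprod.fst : X ⊞ X ⟶ X) ≫ e + S.map (biprod.snd : X ⊞ X ⟶ X) ≫ e'
    have h₁ : S.map biprod.inl ≫ d = e := by simp [d, ← S.map_comp_assoc]
    have h₂ : S.map biprod.inr ≫ d = e' := by simp [d, ← S.map_comp_assoc]
    have h₃ : S.map (biprod.inl + biprod.inr) ≫ d = e + e' := by
      rw [S.map_add, Preadditive.add_comp, h₁, h₂]
    rw [← h₃, hleft, T.map_add, Preadditive.add_comp, ← hleft, ← hleft, h₁, h₂]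
  exact
    { equiv X Y :=
        { toFun := θ
          invFun := θ'
          left_inv e := (hθ' (θ e)).eq hT hS (hθ e).symm
          right_inv e := (hθ (θ' e)).eq hS hT (hθ' e).symm
          map_add' := hadd }
      map_comp_left := hleft
      map_comp_right {X Y Y'} e g := by
        simpa using ((hθ e).comp_map_eq_map_comp hS hT (hθ (e ≫ (S.map g)⟦(1 : ℤ)⟧')) g (𝟙 X)
          (by simp)).symm }

end IsHeartEmbedding

end ShortExactTriangles

/-! ### The derived category of a hereditary abelian category -/

section DerivedCategory

universe w

open Pretriangulated Triangulated DerivedCategory DerivedCategory.TStructure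

variable {A : Type u} [Category.{v} A] [Abelian A] [HasDerivedCategory.{w} A]

lemma isHeartEmbedding_singleFunctor : IsHeartEmbedding (singleFunctor A 0) where
  hom_neg X Y n f hn := by
    have : t.IsGE (((singleFunctor A 0).obj Y)⟦n⟧) (-n) := t.isGE_shift _ 0 n (-n)
    exact t.zero f 0 (-n)
  exists_extension X Y e := by
    obtain ⟨Z, f, g, h⟩ := distinguished_cocone_triangle₂ e
    have : Z.IsLE 0 := t.isLE₂ _ h 0 (inferInstanceAs (((singleFunctor A 0).obj Y).IsLE 0))
      (inferInstanceAs (((singleFunctor A 0).obj X).IsLE 0))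
    have : Z.IsGE 0 := t.isGE₂ _ h 0 (inferInstanceAs (((singleFunctor A 0).obj Y).IsGE 0))
      (inferInstanceAs (((singleFunctor A 0).obj X).IsGE 0))
    obtain ⟨Z', ⟨i⟩⟩ := exists_iso_singleFunctor_obj_of_isGE_of_isLE Z 0
    obtain ⟨f', hf'⟩ := (singleFunctor A 0).map_surjective (f ≫ i.hom)
    obtain ⟨g', hg'⟩ := (singleFunctor A 0).map_surjective (i.inv ≫ g)
    refine ⟨Z', f', g', isomorphic_distinguished _ h _ ?_⟩
    exact Triangle.isoMk _ _ (Iso.refl _) i.symm (Iso.refl _)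
      (show (singleFunctor A 0).map f' ≫ i.inv = 𝟙 _ ≫ f by simp [hf'])
      (show (singleFunctor A 0).map g' ≫ 𝟙 _ = i.inv ≫ g by simp [hg'])
      (show e ≫ (shiftFunctor _ (1 : ℤ)).map (𝟙 _) = 𝟙 _ ≫ e by simp)
  exists_triangle K hK := ⟨_, hK.singleTriangle_distinguished⟩

/-- A morphism of positive degree between objects of the heart of a derived category is killed by
some epimorphism: represent it by a fraction with source a complex concentrated in nonpositive
degrees, and restrict to the term of degree zero of that complex. -/
lemma exists_epi_comp_eq_zero {X Y : A} {n : ℤ} (hn : 0 < n)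
    (f : (singleFunctor A 0).obj X ⟶ ((singleFunctor A 0).obj Y)⟦n⟧) :
    ∃ (P : A) (p : P ⟶ X), Epi p ∧ (singleFunctor A 0).map p ≫ f = 0 := by
  let e := ((singleFunctors A).shiftIso n (-n) 0 (by lia)).app Y
  let X' := (CochainComplex.singleFunctor A 0).obj X
  let Y' := (CochainComplex.singleFunctor A (-n)).obj Y
  let f' : Q.obj X' ⟶ Q.obj Y' := f ≫ e.hom
  have : X'.IsStrictlyLE 0 := inferInstanceAs
    (CochainComplex.IsStrictlyLE ((HomologicalComplex.single A (ComplexShape.up ℤ) 0).obj X) 0)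
  obtain ⟨K, hK, s, hs, g, hg⟩ := right_fac_of_isStrictlyLE f' 0
  let j : (CochainComplex.singleFunctor A 0).obj (K.X 0) ⟶ K :=
    HomologicalComplex.mkHomFromSingle (𝟙 (K.X 0))
      (fun i hi ↦ (K.isZero_of_isStrictlyLE 0 i (by simp at hi; lia)).eq_of_tgt _ _)
  obtain ⟨p, hp⟩ := (CochainComplex.singleFunctor A 0).map_surjective (j ≫ s)
  refine ⟨K.X 0, p, ?_, ?_⟩
  · rw [Preadditive.epi_iff_cancel_zero]
    intro T t ht
    have h : s ≫ (CochainComplex.singleFunctor A 0).map t = 0 := by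
      ext i
      by_cases hi : i = 0
      · subst hi
        have : IsIso (j.f 0) := by
          rw [HomologicalComplex.mkHomFromSingle_f]
          exact ((HomologicalComplex.singleObjXSelf (ComplexShape.up ℤ) 0 (K.X 0)) ≪≫
            Iso.refl _).isIso_hom
        have h := congr_arg (fun φ ↦ φ.f 0) ((Category.assoc j s
          ((CochainComplex.singleFunctor A 0).map t)).symm.trans (by
            rw [← hp, ← Functor.map_comp, ht]))
        rw [← cancel_epi (j.f 0)]
        simpa using h
      · exact (HomologicalComplex.isZero_single_obj_X _ _ _ _ hi).eq_of_tgt _ _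
    have h' : Q.map ((CochainComplex.singleFunctor A 0).map t) = 0 := by
      rw [← cancel_epi (Q.map s), ← Q.map_comp, h, Q.map_zero, comp_zero]
    exact (singleFunctor A 0).map_injective (h'.trans ((singleFunctor A 0).map_zero _ _).symm)
  · have hjg : j ≫ g = 0 := by
      ext i
      by_cases hi : i = 0
      · exact (HomologicalComplex.isZero_single_obj_X _ _ _ _ (by lia)).eq_of_tgt _ _
      · exact (HomologicalComplex.isZero_single_obj_X _ _ _ _ hi).eq_of_src _ _
    have h : Q.map ((CochainComplex.singleFunctor A 0).map p) ≫ f' = 0 := by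
      rw [hp, hg, Q.map_comp, Category.assoc, IsIso.hom_inv_id_assoc, ← Q.map_comp, hjg,
        Q.map_zero]
    rw [← cancel_mono e.hom, zero_comp, Category.assoc]
    exact h

/-- An abelian category is hereditary if the classes of degree one extend along monomorphisms,
i.e. if the first extension functor is right exact in its first argument. -/
lemma isHereditaryAbelian_of_extension
    (h : ∀ ⦃K P Y : A⦄ (i : K ⟶ P) [Mono i]
      (f : (singleFunctor A 0).obj K ⟶ ((singleFunctor A 0).obj Y)⟦(1 : ℤ)⟧),
      ∃ f', (singleFunctor A 0).map i ≫ f' = f) : IsHereditaryAbelian A := by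
  let S := singleFunctor A 0
  have key (n : ℕ) : ∀ ⦃X Y : A⦄ (f : S.obj X ⟶ (S.obj Y)⟦(n + 2 : ℤ)⟧), f = 0 := by
    have step (n : ℤ) (hn : 1 ≤ n)
        (hext : ∀ ⦃K P Y : A⦄ (i : K ⟶ P) [Mono i] (f : S.obj K ⟶ (S.obj Y)⟦n⟧),
          ∃ f', S.map i ≫ f' = f) {X Y : A} (f : S.obj X ⟶ (S.obj Y)⟦n + 1⟧) : f = 0 := by
      obtain ⟨P, p, hp, hpf⟩ := exists_epi_comp_eq_zero (by lia) f
      have hses : (ShortComplex.mk (kernel.ι p) p (kernel.condition p)).ShortExact :=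
        { exact := ShortComplex.exact_of_f_is_kernel _ (kernelIsKernel p) }
      have hT := hses.singleTriangle_distinguished
      obtain ⟨g, rfl⟩ : ∃ g : (S.obj (kernel p))⟦(1 : ℤ)⟧ ⟶ (S.obj Y)⟦n + 1⟧,
        f = hses.singleδ ≫ g := Triangle.yoneda_exact₃ _ hT f hpf
      obtain ⟨k, hk⟩ := (shiftFunctor _ (1 : ℤ)).map_surjective
        (g ≫ (shiftFunctorAdd' _ n 1 (n + 1) rfl).hom.app (S.obj Y))
      obtain ⟨k', rfl⟩ := hext (kernel.ι p) k
      have h₁ : g = (S.map (kernel.ι p) ≫ k')⟦(1 : ℤ)⟧' ≫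
          (shiftFunctorAdd' _ n 1 (n + 1) rfl).inv.app (S.obj Y) := by
        rw [hk, Category.assoc, Iso.hom_inv_id_app, Category.comp_id]
      rw [h₁, Functor.map_comp, Category.assoc]
      have h₂ : hses.singleδ ≫ (S.map (kernel.ι p))⟦(1 : ℤ)⟧' = 0 :=
        comp_distTriang_mor_zero₃₁ _ hT
      rw [reassoc_of% h₂, zero_comp]
    induction n with
    | zero => exact fun X Y f ↦ step 1 le_rfl h f
    | succ n ih =>
      intro X Y f
      refine step (n + 2) (by lia) (fun K P Y i _ f ↦ ⟨0, by simp [ih f]⟩) ?_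
  intro X
  have := HasExt.standard A
  refine HasProjectiveDimensionLT.mk fun i hi Y e ↦ ?_
  apply Abelian.Ext.homEquiv.injective
  obtain ⟨n, rfl⟩ : ∃ n, i = n + 2 := ⟨i - 2, by lia⟩
  exact (key n _).trans (key n _).symm

lemma isHereditaryImage_singleFunctor (hA : IsHereditaryAbelian A) :
    IsHereditaryImage (singleFunctor A 0) := by
  intro X Y n f h₀ h₁
  obtain hn | hn := lt_or_ge n 0
  · exact isHeartEmbedding_singleFunctor.hom_neg f hn
  · obtain ⟨n, rfl⟩ := Int.eq_ofNat_of_zero_le hn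
    have := HasExt.standard A
    have := hA X
    have : Subsingleton (Abelian.Ext X Y n) :=
      HasProjectiveDimensionLT.subsingleton X 2 n (by lia) Y
    exact (Abelian.Ext.homEquiv (X := X) (Y := Y) (n := n)).symm.subsingleton.elim f 0

/-- The objects which are bounded above by `b` and bounded below are finite direct sums of shifts
`X⟦n⟧` of objects of the heart with `-b ≤ n`: by induction on the amplitude, the cohomology
of the highest degree splits off, since the obstruction is a morphism of degree at least `2`. -/
lemma isFiniteSum_of_isGE_of_isLE (hA : IsHereditaryAbelian A) (k : ℕ) (b : ℤ)
    (Z : DerivedCategory A) (hZ : Z.IsGE (b - k)) (hZ' : Z.IsLE b) :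
    IsFiniteSum (fun W ↦ ∃ (X : A) (n : ℤ), -b ≤ n ∧
      Nonempty (W ≅ ((singleFunctor A 0).obj X)⟦n⟧)) Z := by
  have single (b : ℤ) (Z : DerivedCategory A) (_ : Z.IsGE b) (_ : Z.IsLE b) :
      ∃ X : A, Nonempty (Z ≅ ((singleFunctor A 0).obj X)⟦-b⟧) := by
    obtain ⟨X, ⟨e⟩⟩ := exists_iso_singleFunctor_obj_of_isGE_of_isLE Z b
    exact ⟨X, ⟨e ≪≫ (((singleFunctors A).shiftIso (-b) b 0 (by lia)).app X).symm⟩⟩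
  induction k generalizing b Z with
  | zero =>
    obtain ⟨X, ⟨e⟩⟩ := single b Z (by simpa using hZ) hZ'
    exact .of_prop ⟨X, -b, le_rfl, ⟨e⟩⟩
  | succ k ih =>
    obtain ⟨V, W, hV, hW, f, g, d, hT⟩ := t.exists_triangle Z (b - 1) b (by lia)
    have hV : V.IsLE (b - 1) := ⟨hV⟩
    have hW : W.IsGE b := ⟨hW⟩
    have hW' : W.IsLE b := t.isLE₂ _ (rot_of_distTriang _ hT) b hZ'
      (show t.IsLE (V⟦(1 : ℤ)⟧) b from
        have := t.isLE_shift V (b - 1) 1 (b - 2)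
        t.isLE_of_le _ (b - 2) b)
    have hV' : V.IsGE (b - 1 - k) := t.isGE₂ _ (inv_rot_of_distTriang _ hT) (b - 1 - k)
      (show t.IsGE (W⟦(-1 : ℤ)⟧) (b - 1 - k) from
        have := t.isGE_shift W b (-1) (b + 1)
        t.isGE_of_ge _ (b - 1 - k) (b + 1))
      (show t.IsGE Z (b - 1 - k) from t.isGE_of_ge Z (b - 1 - k) (b - (k + 1 : ℕ)))
    obtain ⟨X, ⟨e⟩⟩ := single b W hW hW'
    have hV'' := ih (b - 1) V hV' hV
    let Q : ObjectProperty (DerivedCategory A) := fun V ↦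
      ∀ d : ((singleFunctor A 0).obj X)⟦-b⟧ ⟶ V⟦(1 : ℤ)⟧, d = 0
    have : Q.IsClosedUnderIsomorphisms := ⟨fun {V V'} i hV d ↦ by
      rw [← cancel_mono (i.inv⟦(1 : ℤ)⟧'), hV (d ≫ _), zero_comp]⟩
    have hQ : Q V := by
      refine hV''.le_of_closed (fun O hO d ↦ ((shiftFunctor _ (1 : ℤ)).map_isZero hO).eq_of_tgt _ _)
        (fun V V' hV hV' d ↦ ?_) (fun W ⟨Y, n, hn, ⟨i⟩⟩ ↦ Q.prop_of_iso i.symm fun d ↦ ?_)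
      · rw [← Category.comp_id d, ← (shiftFunctor _ (1 : ℤ)).map_id (V ⊞ V'),
          ← biprod.total, Functor.map_add, Preadditive.comp_add, Functor.map_comp, Functor.map_comp, ← Category.assoc,
          ← Category.assoc, hV (d ≫ _), hV' (d ≫ _), zero_comp, zero_comp, add_zero]
      · rw [← cancel_mono ((shiftFunctorAdd' _ n 1 (n + 1) rfl).inv.app _), zero_comp]
        exact (isHereditaryImage_singleFunctor hA).eq_zero _ (by lia) (by lia)
    have hd : d = 0 := by
      rw [← cancel_epi e.inv, hQ (e.inv ≫ d), comp_zero]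
    obtain ⟨i, -⟩ := exists_iso_binaryBiproduct_of_distTriang _ hT hd
    exact .add (hV''.mono fun W ⟨Y, n, hn, hi⟩ ↦ ⟨Y, n, by lia, hi⟩) ⟨X, -b, le_rfl, ⟨e⟩⟩ i

/-- The objects of the bounded derived category of a hereditary abelian category are finite
direct sums of shifts of objects of the heart. -/
lemma isFiniteSum_of_bounded (hA : IsHereditaryAbelian A) {Z : DerivedCategory A}
    (hZ : t.bounded Z) :
    IsFiniteSum (fun W ↦ ∃ (X : A) (n : ℤ), Nonempty (W ≅ ((singleFunctor A 0).obj X)⟦n⟧)) Z := by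
  obtain ⟨⟨a, ha⟩, ⟨b, hb⟩⟩ := hZ
  refine (isFiniteSum_of_isGE_of_isLE hA (b - a).toNat b Z
    (t.isGE_of_ge Z (b - (b - a).toNat) a) hb).mono fun W ⟨X, n, _, hi⟩ ↦ ⟨X, n, hi⟩

lemma bounded_shift_singleFunctor (X : A) (n : ℤ) :
    (t : TStructure (DerivedCategory A)).bounded (((singleFunctor A 0).obj X)⟦n⟧) :=
  t.bounded.le_shift n _ ⟨⟨0, inferInstance⟩, ⟨0, inferInstance⟩⟩

end DerivedCategory

/-! ### Paths in a triangulated category -/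

section Paths

open Pretriangulated

variable {D : Type u} [Category.{v} D] [Preadditive D] [HasZeroObject D] [HasShift D ℤ]
  [∀ n : ℤ, (shiftFunctor D n).Additive] [Pretriangulated D]

lemma CategoryTheory.Indecomposable.shift {X : D} (hX : Indecomposable X) (n : ℤ) :
    Indecomposable (X⟦n⟧) := by
  have key {Z : D} (h : IsZero (Z⟦-n⟧)) : IsZero Z := by
    rw [IsZero.iff_id_eq_zero] at h ⊢
    exact (shiftFunctor D (-n)).map_injective (by simpa using h)
  refine ⟨fun h ↦ hX.1 (((shiftFunctor D (-n)).map_isZero h).of_iso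
    ((shiftEquiv D n).unitIso.app X)), fun A B e ↦ ?_⟩
  have := preservesBinaryBiproducts_of_preservesBiproducts (shiftFunctor D (-n))
  exact (hX.2 _ _ ((shiftEquiv D n).unitIso.app X ≪≫ (shiftFunctor D (-n)).mapIso e ≪≫
    (shiftFunctor D (-n)).mapBiprod A B)).imp key key

/-- In a triangulated category, split monomorphisms have complements, so that a nonzero split
monomorphism to an indecomposable object is an isomorphism. -/
lemma CategoryTheory.Indecomposable.isIso_of_comp_eq_id {X B : D} (hX : Indecomposable X)
    (hB : ¬ IsZero B) (i : B ⟶ X) (r : X ⟶ B) (h : i ≫ r = 𝟙 B) : IsIso i := by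
  obtain ⟨Z, g, d, hT⟩ := distinguished_cocone_triangle i
  have : IsSplitMono i := ⟨⟨⟨r, h⟩⟩⟩
  have hd : d = 0 := Triangle.mor₃_eq_zero_of_mono₁ _ hT (inferInstanceAs (Mono i))
  obtain ⟨e, -⟩ := exists_iso_binaryBiproduct_of_distTriang _ hT hd
  exact (Triangle.isZero₃_iff_isIso₁ _ hT).1 ((hX.2 _ _ e).resolve_left hB)

/-- A step in a path between indecomposable objects. -/
def PathStep (X Y : D) : Prop :=
  Indecomposable Y ∧ ((∃ f : X ⟶ Y, f ≠ 0) ∨ Nonempty (Y ≅ X⟦(1 : ℤ)⟧))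

lemma hasPath_iff {X Y : D} :
    HasPath X Y ↔ Indecomposable X ∧ Relation.ReflTransGen PathStep X Y := by
  constructor
  · rintro ⟨n, Z, rfl, rfl, hZ, h⟩
    refine ⟨hZ 0 (Nat.zero_le _), ?_⟩
    induction n with
    | zero => exact .refl
    | succ n ih =>
      exact (ih (fun i hi ↦ hZ i (by lia)) (fun i hi ↦ h i (by lia))).tail
        ⟨hZ _ le_rfl, h n (by lia)⟩
  · rintro ⟨hX, h⟩
    induction h with
    | refl => exact ⟨0, fun _ ↦ X, rfl, rfl, fun _ _ ↦ hX, by simp⟩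
    | @tail W Y _ hWY ih =>
      obtain ⟨n, Z, h₀, hn, hZ, h⟩ := ih
      refine ⟨n + 1, fun i ↦ if i ≤ n then Z i else Y, by simpa using h₀, by simp, ?_, ?_⟩
      · intro i hi
        dsimp only
        split_ifs with hi'
        · exact hZ i hi'
        · exact hWY.1
      · intro i hi
        suffices PathStep (if i ≤ n then Z i else Y) (if i + 1 ≤ n then Z (i + 1) else Y) from
          this.2
        obtain hi' | rfl := lt_or_eq_of_le (Nat.lt_succ_iff.1 hi)
        · rw [if_pos hi'.le, if_pos (show i + 1 ≤ n from hi')]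
          exact ⟨hZ _ hi', h i hi'⟩
        · rw [if_pos le_rfl, if_neg (by lia), hn]
          exact hWY

namespace HasPath

lemma indecomposable_left {X Y : D} (h : HasPath X Y) : Indecomposable X :=
  (hasPath_iff.1 h).1

lemma refl {X : D} (hX : Indecomposable X) : HasPath X X :=
  hasPath_iff.2 ⟨hX, .refl⟩

lemma indecomposable_right {X Y : D} (h : HasPath X Y) : Indecomposable Y := by
  obtain ⟨n, Z, -, rfl, hZ, -⟩ := h
  exact hZ n le_rfl

lemma trans {X Y Z : D} (h : HasPath X Y) (h' : HasPath Y Z) : HasPath X Z := by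
  rw [hasPath_iff] at *
  exact ⟨h.1, h.2.trans h'.2⟩

lemma of_hom {X Y : D} (hX : Indecomposable X) (hY : Indecomposable Y) (f : X ⟶ Y) (hf : f ≠ 0) :
    HasPath X Y :=
  hasPath_iff.2 ⟨hX, .single ⟨hY, .inl ⟨f, hf⟩⟩⟩

lemma of_iso {X Y : D} (hX : Indecomposable X) (e : X ≅ Y) : HasPath X Y :=
  of_hom hX (hX.of_iso e) e.hom fun h ↦ hX.1 <| by
    rw [IsZero.iff_id_eq_zero, ← e.hom_inv_id, h, zero_comp]

lemma to_shift_one {X : D} (hX : Indecomposable X) : HasPath X (X⟦(1 : ℤ)⟧) :=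
  hasPath_iff.2 ⟨hX, .single ⟨hX.shift 1, .inr ⟨Iso.refl _⟩⟩⟩

lemma shift {X Y : D} (h : HasPath X Y) (n : ℤ) : HasPath (X⟦n⟧) (Y⟦n⟧) := by
  rw [hasPath_iff] at *
  refine ⟨h.1.shift n, h.2.lift _ fun U V ⟨hV, hUV⟩ ↦ ⟨hV.shift n, ?_⟩⟩
  obtain ⟨f, hf⟩ | ⟨⟨e⟩⟩ := hUV
  · exact .inl ⟨f⟦n⟧', fun h ↦ hf ((shiftFunctor D n).map_injective (by simpa using h))⟩
  · exact .inr ⟨(shiftFunctor D n).mapIso e ≪≫ shiftComm U 1 n⟩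

lemma shift_add {X : D} (hX : Indecomposable X) (m n p : ℤ) (h : m + n = p) :
    HasPath (X⟦p⟧) (X⟦m⟧⟦n⟧) :=
  of_iso (hX.shift p) ((shiftFunctorAdd' D m n p h).app X)

lemma shift_add' {X : D} (hX : Indecomposable X) (m n p : ℤ) (h : m + n = p) :
    HasPath (X⟦m⟧⟦n⟧) (X⟦p⟧) :=
  of_iso ((hX.shift m).shift n) ((shiftFunctorAdd' D m n p h).symm.app X)

lemma to_shift {X : D} (hX : Indecomposable X) (m n : ℤ) (h : m ≤ n) :
    HasPath (X⟦m⟧) (X⟦n⟧) := by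
  obtain ⟨k, rfl⟩ := Int.le.dest h
  induction k with
  | zero => simpa using refl (hX.shift m)
  | succ k ih =>
    exact (ih (by lia)).trans ((to_shift_one (hX.shift _)).trans
      (shift_add' hX (m + k) 1 _ (by push_cast; ring)))

/-- The shift of a path, with the shift of the target absorbed. -/
lemma shift_right {X Y : D} {m : ℤ} (h : HasPath X (Y⟦m⟧)) (hY : Indecomposable Y) (n p : ℤ)
    (hp : m + n = p) : HasPath (X⟦n⟧) (Y⟦p⟧) :=
  (h.shift n).trans (shift_add' hY m n p hp)

lemma shift_zero {X : D} (hX : Indecomposable X) : HasPath X (X⟦(0 : ℤ)⟧) :=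
  of_iso hX ((shiftFunctorZero D ℤ).symm.app X)

lemma of_shift_zero {X : D} (hX : Indecomposable X) : HasPath (X⟦(0 : ℤ)⟧) X :=
  of_iso (hX.shift 0) ((shiftFunctorZero D ℤ).app X)

/-- A nonzero morphism between indecomposable objects gives rise to a path in the opposite
direction up to a shift: any indecomposable direct summand of its cone receives a nonzero morphism
from the target, and has a nonzero morphism to the shift of the source. -/
lemma reverse_of_hom (hD : HasIndecomposableDecompositions D) {X Y : D} (hX : Indecomposable X)
    (hY : Indecomposable Y) (f : X ⟶ Y) (hf : f ≠ 0) : HasPath Y (X⟦(1 : ℤ)⟧) := by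
  by_cases hf' : IsIso f
  · exact (of_iso hY (asIso f).symm).trans (to_shift_one hX)
  obtain ⟨Z, g, d, hT⟩ := distinguished_cocone_triangle f
  have hZ : ¬ IsZero Z := fun h ↦ hf' ((Triangle.isZero₃_iff_isIso₁ _ hT).1 h)
  obtain ⟨B, hB, p, q, hpq⟩ : ∃ (B : D) (_ : Indecomposable B) (p : B ⟶ Z) (q : Z ⟶ B),
      p ≫ q = 𝟙 B := by
    obtain ⟨n, W, hW, ⟨e⟩⟩ := hD Z
    have h := (IsFiniteSum.of_biproduct (P := Indecomposable) W hW).of_iso e.symm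
    cases h with
    | zero h => exact (hZ h).elim
    | @add _ A B hA hB e => exact ⟨B, hB, biprod.inr ≫ e.inv, e.hom ≫ biprod.snd, by simp⟩
  have hfg : f ≫ g = 0 := comp_distTriang_mor_zero₁₂ _ hT
  have hdf : d ≫ f⟦(1 : ℤ)⟧' = 0 := comp_distTriang_mor_zero₃₁ _ hT
  refine (of_hom hY hB (g ≫ q) fun h ↦ hf ?_).trans (of_hom hB (hX.shift 1) (p ≫ d) fun h ↦ hf ?_)
  · obtain ⟨r, hr⟩ : ∃ r : X⟦(1 : ℤ)⟧ ⟶ B, q = d ≫ r := Triangle.yoneda_exact₃ _ hT q h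
    have := (hX.shift 1).isIso_of_comp_eq_id hB.1 (p ≫ d) r (by rw [Category.assoc, ← hr, hpq])
    apply (shiftFunctor D (1 : ℤ)).map_injective
    rw [Functor.map_zero, ← cancel_epi (p ≫ d), Category.assoc, hdf, comp_zero, comp_zero]
  · obtain ⟨s, hs⟩ : ∃ s : B ⟶ Y, p = s ≫ g := Triangle.coyoneda_exact₃ _ hT p h
    have := hY.isIso_of_comp_eq_id hB.1 s (g ≫ q) (by rw [← Category.assoc, ← hs, hpq])
    have : IsSplitMono p := ⟨⟨⟨q, hpq⟩⟩⟩
    have h₁ : f ≫ inv s ≫ p = 0 := by rw [hs, IsIso.inv_hom_id_assoc, hfg]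
    rw [← cancel_mono (inv s), ← cancel_mono p, Category.assoc, h₁, zero_comp, zero_comp]

/-- If there is a path from `X` to `Y`, then there is a path from `Y` to some shift of `X`. -/
lemma exists_reverse (hD : HasIndecomposableDecompositions D) {X Y : D} (h : HasPath X Y) :
    ∃ n : ℤ, HasPath Y (X⟦n⟧) := by
  obtain ⟨hX, h⟩ := hasPath_iff.1 h
  induction h with
  | refl => exact ⟨0, shift_zero hX⟩
  | @tail W Y hXW hWY ih =>
    obtain ⟨n, hn⟩ := ih (hasPath_iff.2 ⟨hX, hXW⟩)
    have hW := hn.indecomposable_left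
    refine ⟨n + 1, HasPath.trans ?_ (hn.shift_right hX 1 (n + 1) rfl)⟩
    obtain ⟨hY, ⟨f, hf⟩ | ⟨⟨e⟩⟩⟩ := hWY
    · exact reverse_of_hom hD hW hY f hf
    · exact of_iso hY e

end HasPath

/-! ### Connectedness of blocks -/

/-- There is a path from `X` to some shift of `Y`. -/
def IsLinked (X Y : D) : Prop := ∃ n : ℤ, HasPath X (Y⟦n⟧)

namespace IsLinked

lemma of_hasPath {X Y : D} (h : HasPath X Y) : IsLinked X Y :=
  ⟨0, h.trans (HasPath.shift_zero h.indecomposable_right)⟩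

lemma trans {X Y Z : D} (hZ : Indecomposable Z) (h : IsLinked X Y) (h' : IsLinked Y Z) :
    IsLinked X Z := by
  obtain ⟨n, hn⟩ := h
  obtain ⟨m, hm⟩ := h'
  exact ⟨m + n, hn.trans (hm.shift_right hZ n _ rfl)⟩

lemma symm (hD : HasIndecomposableDecompositions D) {X Y : D} (hY : Indecomposable Y)
    (h : IsLinked X Y) : IsLinked Y X := by
  obtain ⟨n, hn⟩ := h
  obtain ⟨m, hm⟩ := hn.exists_reverse hD
  have hX := hn.indecomposable_left
  exact ⟨m + -n, ((HasPath.shift_zero hY).trans (HasPath.shift_add hY n (-n) 0 (by lia))).trans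
    (hm.shift_right hX (-n) _ rfl)⟩

lemma shift_right {X Y : D} (hY : Indecomposable Y) (h : IsLinked X Y) (n : ℤ) :
    IsLinked X (Y⟦n⟧) := by
  obtain ⟨m, hm⟩ := h
  exact ⟨m - n, hm.trans (HasPath.shift_add hY n (m - n) m (by lia))⟩

lemma of_shift_right {X Y : D} (hY : Indecomposable Y) {n : ℤ} (h : IsLinked X (Y⟦n⟧)) :
    IsLinked X Y := by
  obtain ⟨m, hm⟩ := h
  exact ⟨n + m, hm.trans (HasPath.shift_add' hY n m _ rfl)⟩

end IsLinked

/-- In a block, any two indecomposable objects are linked: otherwise, the objects all of whose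
indecomposable summands are linked to a given one, and those none of whose summands is, would
form a decomposition. -/
lemma IsBlock.isLinked (hblock : IsBlock D) (hD : HasIndecomposableDecompositions D) {X Y : D}
    (hX : Indecomposable X) (hY : Indecomposable Y) : IsLinked X Y := by
  by_contra hXY
  let L : ObjectProperty D := fun W ↦ Indecomposable W ∧ IsLinked X W
  let N : ObjectProperty D := fun W ↦ Indecomposable W ∧ ¬ IsLinked X W
  have hL : L.IsStableUnderShift ℤ :=
    ⟨fun n ↦ ⟨fun W hW ↦ ⟨hW.1.shift n, hW.2.shift_right hW.1 n⟩⟩⟩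
  have hN : N.IsStableUnderShift ℤ :=
    ⟨fun n ↦ ⟨fun W hW ↦ ⟨hW.1.shift n, fun h ↦ hW.2 (h.of_shift_right hW.1)⟩⟩⟩
  have hLN {U V : D} (hU : L U) (hV : N V) (f : U ⟶ V) : f = 0 := by
    by_contra hf
    exact hV.2 (hU.2.trans hV.1 (.of_hasPath (.of_hom hU.1 hV.1 f hf)))
  have hNL {U V : D} (hU : N U) (hV : L V) (f : U ⟶ V) : f = 0 := by
    by_contra hf
    exact hU.2 (hV.2.trans hU.1
      ((IsLinked.of_hasPath (.of_hom hU.1 hV.1 f hf)).symm hD hV.1))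
  have hsum (Z : D) : IsFiniteSum Indecomposable Z := by
    obtain ⟨n, W, hW, ⟨e⟩⟩ := hD Z
    exact (IsFiniteSum.of_biproduct W hW).of_iso e.symm
  have hL' {Z : D} (hZ : N.leftOrthogonal Z) : IsFiniteSum L Z :=
    (hsum Z).refine fun B i r hir hB ↦ ⟨hB, by
      by_contra h
      exact hB.1 (by rw [IsZero.iff_id_eq_zero, ← hir, hZ r ⟨hB, h⟩, comp_zero])⟩
  have hN' {Z : D} (hZ : L.leftOrthogonal Z) : IsFiniteSum N Z :=
    (hsum Z).refine fun B i r hir hB ↦ ⟨hB, fun h ↦ hB.1 (by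
      rw [IsZero.iff_id_eq_zero, ← hir, hZ r ⟨hB, h⟩, comp_zero])⟩
  obtain h | h := hblock.trivial_of_decomposition N.leftOrthogonal L.leftOrthogonal
    { isTriangulated_left := inferInstance
      isTriangulated_right := inferInstance
      hom_eq_zero U V hU hV f := (hN' hV).eq_zero_of_forall_to (fun B hB f ↦ hU f hB) f
      hom_eq_zero' U V hU hV f := (hL' hU).eq_zero_of_forall_to (fun B hB f ↦ hV f hB) f
      exists_iso_biprod Z := by
        obtain ⟨U, V, hU, hV, e⟩ := (hsum Z).exists_partition (IsLinked X)
        exact ⟨U, V, fun W f hW ↦ hU.eq_zero_of_forall_from (fun B hB f ↦ hLN hB hW f) f,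
          fun W f hW ↦ hV.eq_zero_of_forall_from (fun B hB f ↦ hNL hB hW f) f, e⟩ }
  · exact hX.1 (h X fun W f hW ↦ hLN ⟨hX, .of_hasPath (.refl hX)⟩ hW f)
  · exact hY.1 (h Y fun W f hW ↦ hNL ⟨hY, hXY⟩ hW f)

/-- If in a block some indecomposable object `Z` has a path from `Z⟦1⟧` to `Z`, then there are
paths from `Z` to all its negative shifts, hence paths between any two indecomposable objects. -/
lemma IsBlock.hasPath_of_hasPath_shift (hblock : IsBlock D)
    (hD : HasIndecomposableDecompositions D) {Z : D} (hZ : HasPath (Z⟦(1 : ℤ)⟧) Z) {X Y : D}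
    (hX : Indecomposable X) (hY : Indecomposable Y) : HasPath Y X := by
  have hZ' := hZ.indecomposable_right
  have down (n : ℤ) (k : ℕ) : HasPath (Z⟦n⟧) (Z⟦n - k⟧) := by
    induction k with
    | zero => simpa using HasPath.refl (hZ'.shift n)
    | succ k ih =>
      refine ih.trans (HasPath.trans ?_ (hZ.shift (n - (k + 1 : ℕ))))
      exact HasPath.shift_add hZ' _ _ _ (by push_cast; ring)
  obtain ⟨i, hi⟩ := hblock.isLinked hD hY hZ'
  obtain ⟨j, hj⟩ := hblock.isLinked hD hZ' hX
  have h : HasPath (Z⟦i⟧) (Z⟦-j⟧) := by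
    obtain h | h := le_total i (-j)
    · exact .to_shift hZ' _ _ h
    · simpa using down i (i + j).toNat |>.trans (.to_shift hZ' _ _ (by lia))
  exact hi.trans (h.trans ((hj.shift_right hX (-j) 0 (by lia)).trans (.of_shift_zero hX)))

end Paths

/-! ### Hereditary hearts -/

section HereditaryHearts

open Pretriangulated Triangulated

variable {D : Type u} [Category.{v} D] [Preadditive D] [HasZeroObject D] [HasShift D ℤ]
  [∀ n : ℤ, (shiftFunctor D n).Additive] [Pretriangulated D]

/-- A property `P` of objects of a triangulated category which is closed under finite direct sums
defines a hereditary heart if the morphisms between shifts of objects satisfying `P` are of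
degree `0` or `1`, and if every object is a finite direct sum of shifts of such objects. -/
structure IsHereditaryHeart (P : ObjectProperty D) : Prop where
  prop_of_iso ⦃X Y : D⦄ (e : X ≅ Y) : P X → P Y
  prop_of_isZero ⦃X : D⦄ : IsZero X → P X
  prop_biprod ⦃X Y : D⦄ : P X → P Y → P (X ⊞ Y)
  isHereditaryImage : IsHereditaryImage P.ι
  isFiniteSum (Z : D) :
    IsFiniteSum (fun W ↦ ∃ (B : D) (n : ℤ), P B ∧ Nonempty (W ≅ B⟦n⟧)) Z

namespace IsHereditaryHeart

variable {P : ObjectProperty D} (hP : IsHereditaryHeart P)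
include hP

lemma isClosedUnderIsomorphisms : P.IsClosedUnderIsomorphisms := ⟨fun e ↦ hP.prop_of_iso e⟩

lemma shift_hom_eq_zero {X Y : D} (hX : P X) (hY : P Y) {m n : ℤ} (h₀ : n ≠ m) (h₁ : 1 + m ≠ n)
    (f : X⟦m⟧ ⟶ Y⟦n⟧) : f = 0 :=
  hP.isHereditaryImage.eq_zero (X := ⟨X, hX⟩) (Y := ⟨Y, hY⟩) f h₀ h₁

lemma shift_hom_eq_zero_left {X Y : D} (hX : P X) (hY : P Y) {m : ℤ} (h₀ : m ≠ 0) (h₁ : m ≠ -1)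
    (f : X⟦m⟧ ⟶ Y) : f = 0 := by
  rw [← cancel_mono ((shiftFunctorZero D ℤ).inv.app Y), zero_comp]
  exact hP.shift_hom_eq_zero hX hY (by lia) (by lia) _

lemma shift_hom_eq_zero_right {X Y : D} (hX : P X) (hY : P Y) {n : ℤ} (h₀ : n ≠ 0) (h₁ : n ≠ 1)
    (f : X ⟶ Y⟦n⟧) : f = 0 :=
  hP.isHereditaryImage ⟨X, hX⟩ ⟨Y, hY⟩ n f h₀ h₁

/-- The degrees of the summands of the middle term of a distinguished triangle are constrained by
the outer terms. -/
lemma isFiniteSum_obj₂ (R : ℤ → Prop) {n₀ : ℤ} (hn₀ : R n₀) (T : Triangle D)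
    (hT : T ∈ distTriang D)
    (h : ∀ ⦃B : D⦄ (n : ℤ), P B → ¬ R n →
      ((∀ f : B⟦n⟧ ⟶ T.obj₁, f = 0) ∧ (∀ f : B⟦n⟧ ⟶ T.obj₃, f = 0)) ∨
      ((∀ f : T.obj₁ ⟶ B⟦n⟧, f = 0) ∧ (∀ f : T.obj₃ ⟶ B⟦n⟧, f = 0))) :
    IsFiniteSum (fun W ↦ ∃ (B : D) (n : ℤ), P B ∧ R n ∧ Nonempty (W ≅ B⟦n⟧)) T.obj₂ := by
  refine (hP.isFiniteSum T.obj₂).refine ?_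
  rintro W i r hir ⟨B, n, hB, ⟨e⟩⟩
  by_cases hn : R n
  · exact ⟨B, n, hB, hn, ⟨e⟩⟩
  suffices hW : IsZero W from
    ⟨W, n₀, hP.prop_of_isZero hW, hn₀, ⟨hW.iso ((shiftFunctor D n₀).map_isZero hW)⟩⟩
  rw [IsZero.iff_id_eq_zero, ← hir]
  obtain ⟨h₁, h₃⟩ | ⟨h₁, h₃⟩ := h n hB hn
  · have : e.inv ≫ i = 0 := by
      obtain ⟨g, hg⟩ := Triangle.coyoneda_exact₂ T hT (e.inv ≫ i) (h₃ _)
      rw [hg, h₁ g, zero_comp]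
    rw [← e.hom_inv_id_assoc i, this, comp_zero, zero_comp]
  · have : r ≫ e.hom = 0 := by
      obtain ⟨g, hg⟩ := Triangle.yoneda_exact₂ T hT (r ≫ e.hom) (h₁ _)
      rw [hg, h₃ g, comp_zero]
    rw [← Category.comp_id r, ← e.hom_inv_id, reassoc_of% this, zero_comp, comp_zero]

/-- Finite direct sums of shifts by `n` of objects of the heart are of this form. -/
lemma exists_iso_shift (n : ℤ) {Z : D}
    (hZ : IsFiniteSum (fun W ↦ ∃ B : D, P B ∧ Nonempty (W ≅ B⟦n⟧)) Z) :
    ∃ B : D, P B ∧ Nonempty (Z ≅ B⟦n⟧) := by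
  have := preservesBinaryBiproducts_of_preservesBiproducts (shiftFunctor D n)
  let Q : ObjectProperty D := fun W ↦ ∃ B : D, P B ∧ Nonempty (W ≅ B⟦n⟧)
  have : Q.IsClosedUnderIsomorphisms := ⟨fun e ⟨B, hB, ⟨e'⟩⟩ ↦ ⟨B, hB, ⟨e.symm ≪≫ e'⟩⟩⟩
  exact hZ.le_of_closed (Q := Q)
    (fun X hX ↦ ⟨X, hP.prop_of_isZero hX, ⟨hX.iso ((shiftFunctor D n).map_isZero hX)⟩⟩)
    (fun X Y ⟨B, hB, ⟨e⟩⟩ ⟨B', hB', ⟨e'⟩⟩ ↦ ⟨B ⊞ B', hP.prop_biprod hB hB',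
      ⟨biprod.mapIso e e' ≪≫ ((shiftFunctor D n).mapBiprod B B').symm⟩⟩) (fun _ h ↦ h)

lemma prop_of_isFiniteSum {Z : D}
    (hZ : IsFiniteSum (fun W ↦ ∃ B : D, P B ∧ Nonempty (W ≅ B⟦(0 : ℤ)⟧)) Z) : P Z := by
  obtain ⟨B, hB, ⟨e⟩⟩ := hP.exists_iso_shift 0 hZ
  exact hP.prop_of_iso (e ≪≫ (shiftFunctorZero D ℤ).app B).symm hB

lemma prop_obj₂ (T : Triangle D) (hT : T ∈ distTriang D) (h₁ : P T.obj₁) (h₃ : P T.obj₃) :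
    P T.obj₂ := by
  refine hP.prop_of_isFiniteSum ((hP.isFiniteSum_obj₂ (· = 0) rfl T hT fun B n hB hn ↦ ?_).mono
    fun W ⟨B, n, hB, hn, e⟩ ↦ ⟨B, hB, hn ▸ e⟩)
  by_cases hn' : n = -1
  · exact .inr ⟨hP.shift_hom_eq_zero_right h₁ hB hn (by lia),
      hP.shift_hom_eq_zero_right h₃ hB hn (by lia)⟩
  · exact .inl ⟨hP.shift_hom_eq_zero_left hB h₁ hn hn', hP.shift_hom_eq_zero_left hB h₃ hn hn'⟩

lemma isTriangulatedClosed₂ : P.IsTriangulatedClosed₂ :=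
  have := hP.isClosedUnderIsomorphisms
  .mk' hP.prop_obj₂

lemma hasFiniteProducts : HasFiniteProducts P.FullSubcategory := by
  have := hP.isClosedUnderIsomorphisms
  have : P.ContainsZero := ⟨_, isZero_zero D, hP.prop_of_isZero (isZero_zero D)⟩
  have : P.IsClosedUnderBinaryProducts := ⟨by
    rintro X ⟨p⟩
    refine P.prop_of_iso ?_ (hP.prop_biprod (p.prop_diag_obj (.mk .left))
      (p.prop_diag_obj (.mk .right)))
    exact IsLimit.conePointUniqueUpToIso (BinaryBiproduct.isLimit _ _)
      ((IsLimit.postcomposeHomEquiv (diagramIsoPair p.diag) _).2 p.isLimit)⟩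
  have : P.IsClosedUnderFiniteProducts := .mk'
  infer_instance

/-- The cone of a morphism in the heart has summands in degrees `0` and `1` only: the former give
the cokernel, the latter the kernel. -/
lemma admissibleMorphism_eq_top : AbelianSubcategory.admissibleMorphism P.ι = ⊤ := by
  refine eq_top_iff.2 fun X Y f _ Z g d hT ↦ ?_
  have hX := X.2
  have hY := Y.2
  have hZ : IsFiniteSum (fun W ↦ ∃ (B : D) (n : ℤ), P B ∧ (n = 0 ∨ n = 1) ∧
      Nonempty (W ≅ B⟦n⟧)) Z := by
    refine hP.isFiniteSum_obj₂ (fun n ↦ n = 0 ∨ n = 1) (.inl rfl) _ (rot_of_distTriang _ hT)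
      fun B n hB hn ↦ ?_
    by_cases hn' : n = 2
    · exact .inl ⟨hP.shift_hom_eq_zero_left hB hY (by lia) (by lia),
        hP.shift_hom_eq_zero hB hX (by lia) (by lia)⟩
    · exact .inr ⟨hP.shift_hom_eq_zero_right hY hB (by lia) (by lia),
        hP.shift_hom_eq_zero hX hB (by lia) (by lia)⟩
  obtain ⟨U, V, hU, hV, ⟨e⟩⟩ := hZ.exists_partition
    (fun W ↦ ∃ B : D, P B ∧ Nonempty (W ≅ B⟦(1 : ℤ)⟧))
  obtain ⟨K, hK, ⟨k⟩⟩ := hP.exists_iso_shift 1 (hU.mono fun W h ↦ h.2)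
  have hV : P V := hP.prop_of_isFiniteSum (hV.mono fun W ⟨⟨B, n, hB, hn, e⟩, h⟩ ↦ by
    obtain rfl | rfl := hn
    · exact ⟨B, hB, e⟩
    · exact (h ⟨B, hB, e⟩).elim)
  refine ⟨⟨K, hK⟩, ⟨V, hV⟩, k.inv ≫ biprod.inl ≫ e.inv, e.hom ≫ biprod.snd, 0,
    isomorphic_distinguished _ (binaryBiproductTriangle_distinguished U V) _ ?_⟩
  exact Triangle.isoMk _ _ k.symm e (Iso.refl _)
    (show (k.inv ≫ biprod.inl ≫ e.inv) ≫ e.hom = k.inv ≫ biprod.inl by simp)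
    (show (e.hom ≫ biprod.snd) ≫ 𝟙 _ = e.hom ≫ biprod.snd by simp)
    (show (0 : V ⟶ K⟦(1 : ℤ)⟧⟦(1 : ℤ)⟧) ≫ k.inv⟦(1 : ℤ)⟧' = 𝟙 V ≫ 0 by simp)

lemma hom_neg ⦃X Y : P.FullSubcategory⦄ ⦃n : ℤ⦄ (f : P.ι.obj X ⟶ (P.ι.obj Y)⟦n⟧) (hn : n < 0) :
    f = 0 :=
  hP.isHereditaryImage X Y n f (by lia) (by lia)

/-- A hereditary heart is an abelian category, and its short exact sequences are the distinguished
triangles with terms in the heart. -/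
theorem exists_abelian [IsTriangulated D] :
    ∃ (A : Type u) (_ : Category.{v} A) (_ : Abelian A) (S : A ⥤ D),
      S.Full ∧ S.Faithful ∧ S.Additive ∧ IsHeartEmbedding S ∧ IsHereditaryImage S ∧
        ∀ B, P B → ∃ X, Nonempty (B ≅ S.obj X) := by
  have := hP.hasFiniteProducts
  have := hP.isTriangulatedClosed₂
  let _ : Abelian P.FullSubcategory :=
    AbelianSubcategory.abelian P.ι hP.hom_neg hP.admissibleMorphism_eq_top
  refine ⟨P.FullSubcategory, inferInstance, inferInstance, P.ι, inferInstance, inferInstance,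
    inferInstance, ⟨hP.hom_neg, fun X Y e ↦ ?_, fun K hK ↦ ?_⟩, hP.isHereditaryImage,
    fun B hB ↦ ⟨⟨B, hB⟩, ⟨Iso.refl _⟩⟩⟩
  · obtain ⟨Z, hZ, f, g, h⟩ := P.distinguished_cocone_triangle₂ e Y.2 X.2
    exact ⟨⟨Z, hZ⟩, ObjectProperty.homMk f, ObjectProperty.homMk g, h⟩
  · have := hK.epi_g
    obtain ⟨X, i, e, hT⟩ := AbelianSubcategory.exists_distinguished_triangle_of_epi hP.hom_neg
      hP.admissibleMorphism_eq_top K.g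
    let j : K.X₁ ≅ X := IsLimit.conePointUniqueUpToIso hK.fIsKernel
      (AbelianSubcategory.isLimitKernelForkOfDistTriang hP.hom_neg i K.g e hT)
    have hj : j.hom ≫ i = K.f := IsLimit.conePointUniqueUpToIso_hom_comp hK.fIsKernel
      (AbelianSubcategory.isLimitKernelForkOfDistTriang hP.hom_neg i K.g e hT)
      WalkingParallelPair.zero
    refine ⟨e ≫ (P.ι.map j.inv)⟦(1 : ℤ)⟧', isomorphic_distinguished _ hT _ ?_⟩
    refine Triangle.isoMk _ _ (P.ι.mapIso j) (Iso.refl _) (Iso.refl _) ?_ ?_ ?_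
    · exact (Category.comp_id _).trans ((P.ι.congr_map hj.symm).trans (P.ι.map_comp _ _))
    · exact (Category.comp_id _).trans (Category.id_comp _).symm
    · change (e ≫ (P.ι.map j.inv)⟦(1 : ℤ)⟧') ≫ (P.ι.map j.hom)⟦(1 : ℤ)⟧' = 𝟙 _ ≫ e
      rw [Category.assoc, ← Functor.map_comp, ← Functor.map_comp, j.inv_hom_id]
      simp

end IsHereditaryHeart

end HereditaryHearts

/-! ### Hereditary hearts from paths -/

section HeartOfPaths

open Pretriangulated

variable {D : Type u} [Category.{v} D] [Preadditive D] [HasZeroObject D] [HasShift D ℤ]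
  [∀ n : ℤ, (shiftFunctor D n).Additive] [Pretriangulated D]

lemma IsFiniteSum.shift {P : ObjectProperty D} {X : D} (hX : IsFiniteSum P X) (n : ℤ) :
    IsFiniteSum (fun W ↦ ∃ B, P B ∧ Nonempty (W ≅ B⟦n⟧)) (X⟦n⟧) := by
  have := preservesBinaryBiproducts_of_preservesBiproducts (shiftFunctor D n)
  induction hX with
  | zero h => exact .zero ((shiftFunctor D n).map_isZero h)
  | @add X A B hA hB e ih =>
    exact .add ih ⟨B, hB, ⟨Iso.refl _⟩⟩
      ((shiftFunctor D n).mapIso e ≪≫ (shiftFunctor D n).mapBiprod A B)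

/-- The indecomposable objects which have a path from `X₀`, and whose shift by `-1` has none. -/
def IsPathFront (X₀ : D) : ObjectProperty D := fun Y ↦
  Indecomposable Y ∧ HasPath X₀ Y ∧ ¬ HasPath X₀ (Y⟦(-1 : ℤ)⟧)

namespace IsPathFront

variable {X₀ : D}

/-- Each indecomposable object linked to `X₀` has a shift in the front. -/
lemma exists_iso_shift (hD : HasIndecomposableDecompositions D)
    (hno : ∀ X : D, Indecomposable X → ¬ HasPath (X⟦(1 : ℤ)⟧) X) {Y : D} (hY : Indecomposable Y)
    (h : IsLinked X₀ Y) : ∃ (B : D) (n : ℤ), IsPathFront X₀ B ∧ Nonempty (Y ≅ B⟦n⟧) := by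
  obtain ⟨j, hj⟩ := h.symm hD hY
  have hX₀ : Indecomposable X₀ := h.choose_spec.indecomposable_left
  have hbdd (i : ℤ) (hi : HasPath X₀ (Y⟦i⟧)) : -j ≤ i := by
    by_contra! hij
    have h₁ : HasPath X₀ (X₀⟦i + j⟧) := hi.trans (by
      simpa only [add_comm] using hj.shift_right hX₀ i (i + j) (by lia))
    refine hno X₀ hX₀ ((h₁.shift_right hX₀ 1 (i + j + 1) rfl).trans
      ((HasPath.to_shift hX₀ _ 0 (by lia)).trans (.of_shift_zero hX₀)))
  obtain ⟨m, hm, hmin⟩ := Int.exists_least_of_bdd (P := fun i ↦ HasPath X₀ (Y⟦i⟧)) ⟨-j, hbdd⟩ h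
  refine ⟨Y⟦m⟧, -m, ⟨hY.shift m, hm, fun h' ↦ ?_⟩, ⟨?_⟩⟩
  · have := hmin (m - 1) (h'.trans (HasPath.shift_add' hY m (-1) (m - 1) (by lia)))
    lia
  · exact (shiftFunctorZero D ℤ).symm.app Y ≪≫ (shiftFunctorAdd' D m (-m) 0 (by lia)).app Y

lemma hom_eq_zero (hD : HasIndecomposableDecompositions D) {Y Z : D} (hY : IsPathFront X₀ Y)
    (hZ : IsPathFront X₀ Z) {n : ℤ} (h₀ : n ≠ 0) (h₁ : n ≠ 1) (f : Y ⟶ Z⟦n⟧) : f = 0 := by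
  by_contra hf
  obtain hn | hn := lt_or_ge n 0
  · exact hZ.2.2 (hY.2.1.trans ((HasPath.of_hom hY.1 (hZ.1.shift n) f hf).trans
      (.to_shift hZ.1 _ _ (by lia))))
  · have h₂ : HasPath (Z⟦n⟧) (Y⟦(1 : ℤ)⟧) := .reverse_of_hom hD hY.1 (hZ.1.shift n) f hf
    have h₃ : HasPath (Z⟦n⟧⟦(-2 : ℤ)⟧) (Y⟦(-1 : ℤ)⟧) := h₂.shift_right hY.1 (-2) (-1) (by lia)
    exact hY.2.2 (hZ.2.1.trans ((HasPath.shift_zero hZ.1).trans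
      ((HasPath.to_shift hZ.1 0 (n - 2) (by lia)).trans
        ((HasPath.shift_add hZ.1 n (-2) (n - 2) (by lia)).trans h₃))))

/-- If no indecomposable object has a path from its shift, then the finite direct sums of the
objects of the front form a hereditary heart. -/
theorem isHereditaryHeart (hD : HasIndecomposableDecompositions D)
    (hno : ∀ X : D, Indecomposable X → ¬ HasPath (X⟦(1 : ℤ)⟧) X)
    (hlinked : ∀ Y : D, Indecomposable Y → IsLinked X₀ Y) :
    IsHereditaryHeart (IsFiniteSum (IsPathFront X₀)) where
  prop_of_iso _ _ e h := h.of_iso e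
  prop_of_isZero _ h := .zero h
  prop_biprod _ _ h h' := h.biprod h'
  isHereditaryImage X Y n f h₀ h₁ :=
    X.2.eq_zero_of_forall_from (fun B hB f ↦ (Y.2.shift n).eq_zero_of_forall_to
      (fun B' ⟨C, hC, ⟨e⟩⟩ f ↦ by
        rw [← cancel_mono e.hom, zero_comp]
        exact hB.hom_eq_zero hD hC h₀ h₁ _) f) f
  isFiniteSum Z := by
    obtain ⟨n, W, hW, ⟨e⟩⟩ := hD Z
    refine ((IsFiniteSum.of_biproduct (P := Indecomposable) W hW).of_iso e.symm).mono
      fun Y hY ↦ ?_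
    obtain ⟨B, n, hB, e⟩ := exists_iso_shift hD hno hY (hlinked Y hY)
    exact ⟨B, n, .of_prop hB, e⟩

end IsPathFront

end HeartOfPaths

/-! ### Triangulated categories with a hereditary heart -/

section Hereditary

set_option linter.unusedSectionVars false

open Pretriangulated Triangulated DerivedCategory DerivedCategory.TStructure

variable {D : Type u} [Category.{v} D] [Preadditive D] [HasZeroObject D] [HasShift D ℤ]
  [∀ n : ℤ, (shiftFunctor D n).Additive] [Pretriangulated D]
  {A : Type u} [Category.{v} A] [Abelian A] {S : A ⥤ D} [S.Full] [S.Faithful] [S.Additive]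

/-- In the presence of a triangle for each short exact sequence, the vanishing of morphisms of
degree two implies that morphisms of degree one extend along monomorphisms. -/
lemma IsHeartEmbedding.exists_extension_of_mono (hS : IsHeartEmbedding S)
    (hS' : IsHereditaryImage S) {K P Y : A} (i : K ⟶ P) [Mono i]
    (f : S.obj K ⟶ (S.obj Y)⟦(1 : ℤ)⟧) : ∃ f', S.map i ≫ f' = f := by
  have hses : (ShortComplex.mk i (cokernel.π i) (cokernel.condition i)).ShortExact :=
    { exact := ShortComplex.exact_of_g_is_cokernel _ (cokernelIsCokernel i) }
  obtain ⟨e, hT⟩ := hS.exists_triangle hses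
  have hT' := inv_rot_of_distTriang _ hT
  obtain ⟨f', hf'⟩ : ∃ f' : S.obj P ⟶ (S.obj Y)⟦(1 : ℤ)⟧, f = S.map i ≫ f' :=
    Triangle.yoneda_exact₂ _ hT' f (hS'.eq_zero (m := -1) (n := 1) _ (by lia) (by lia))
  exact ⟨f', hf'.symm⟩

lemma IsHeartEmbedding.isHereditaryAbelian (hS : IsHeartEmbedding S) (hS' : IsHereditaryImage S) :
    IsHereditaryAbelian A := by
  let _ := HasDerivedCategory.standard A
  let θ := hS.extComparison (isHeartEmbedding_singleFunctor (A := A))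
  refine isHereditaryAbelian_of_extension fun K P Y i _ f ↦ ?_
  obtain ⟨f', hf'⟩ := hS.exists_extension_of_mono hS' i ((θ.equiv K Y).symm f)
  exact ⟨θ.equiv P Y f', by rw [← θ.map_comp_left, hf', AddEquiv.apply_symm_apply]⟩

/-- If the image of `S` is a hereditary heart, the triangulated category is equivalent to the
bounded derived category of the heart. -/
theorem IsHeartEmbedding.isHereditaryTriangulated (hS : IsHeartEmbedding S)
    (hS' : IsHereditaryImage S)
    (h : ∀ Z : D, IsFiniteSum (fun W ↦ ∃ (X : A) (n : ℤ), Nonempty (W ≅ (S.obj X)⟦n⟧)) Z) :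
    IsHereditaryTriangulated D := by
  have hA := hS.isHereditaryAbelian hS'
  refine ⟨A, inferInstance, inferInstance, hA, ?_⟩
  let _ := HasDerivedCategory.standard A
  have : HasFiniteBiproducts D := HasFiniteBiproducts.of_hasFiniteProducts
  have : HasFiniteBiproducts (DerivedCategory A) := HasFiniteBiproducts.of_hasFiniteProducts
  obtain ⟨Ψ, _, _, _, hΨ, ⟨c⟩⟩ := (hS.extComparison (isHeartEmbedding_singleFunctor
    (A := A))).exists_functor hS' (isHereditaryImage_singleFunctor hA) h
  have := preservesBinaryBiproducts_of_preservesBiproducts Ψ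
  let t : TStructure (DerivedCategory A) := DerivedCategory.TStructure.t
  let Q : ObjectProperty D := fun Z ↦ t.bounded (Ψ.obj Z)
  have : Q.IsClosedUnderIsomorphisms := ⟨fun e h ↦ t.bounded.prop_of_iso (Ψ.mapIso e) h⟩
  have hbdd (Z : D) : t.bounded (Ψ.obj Z) := by
    refine (h Z).le_of_closed (Q := Q) (fun X hX ↦ t.bounded.prop_of_isZero (Ψ.map_isZero hX))
      (fun X Y hX hY ↦ ?_) (fun W ⟨X, n, ⟨e⟩⟩ ↦ ?_)
    · exact t.bounded.prop_of_iso (Ψ.mapBiprod X Y).symm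
        (t.bounded.ext_of_isTriangulatedClosed₂ _ (binaryBiproductTriangle_distinguished _ _)
          hX hY)
    · exact t.bounded.prop_of_iso (Ψ.mapIso e ≪≫ (hΨ X n).some).symm
        (bounded_shift_singleFunctor X n)
  let Φ : D ⥤ Bounded A := t.bounded.lift Ψ hbdd
  have : Φ.EssSurj := ⟨fun Z ↦ by
    obtain ⟨Y, ⟨e⟩⟩ := (isFiniteSum_of_bounded hA Z.2).le_of_closed (Q := Ψ.essImage)
      (fun X hX ↦ ⟨_, ⟨(Ψ.map_isZero (isZero_zero D)).iso hX⟩⟩)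
      (fun X Y ⟨X', ⟨e⟩⟩ ⟨Y', ⟨e'⟩⟩ ↦ ⟨X' ⊞ Y', ⟨Ψ.mapBiprod X' Y' ≪≫ biprod.mapIso e e'⟩⟩)
      (fun W ⟨X, n, ⟨e⟩⟩ ↦ ⟨(S.obj X)⟦n⟧, ⟨(hΨ X n).some ≪≫ e.symm⟩⟩)
    exact ⟨Y, ⟨t.bounded.fullyFaithfulι.preimageIso e⟩⟩⟩
  have : Φ.IsEquivalence := { }
  have c' : shiftFunctor D (1 : ℤ) ⋙ Φ ≅ Φ ⋙ shiftFunctor (Bounded A) (1 : ℤ) :=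
    (t.bounded.fullyFaithfulι.whiskeringRight D).preimageIso
      (c ≪≫ Functor.isoWhiskerLeft Φ (t.bounded.ι.commShiftIso (1 : ℤ)).symm)
  let E := Φ.asEquivalence
  refine ⟨E.symm, ⟨?_⟩⟩
  let η : Φ ⋙ Φ.inv ≅ 𝟭 _ := E.unitIso.symm
  let ε : Φ.inv ⋙ Φ ≅ 𝟭 _ := E.counitIso
  change shiftFunctor (Bounded A) (1 : ℤ) ⋙ Φ.inv ≅ Φ.inv ⋙ shiftFunctor D (1 : ℤ)
  exact Functor.isoWhiskerRight ε.symm (shiftFunctor (Bounded A) (1 : ℤ) ⋙ Φ.inv) ≪≫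
    Functor.isoWhiskerLeft Φ.inv (Functor.isoWhiskerRight c'.symm Φ.inv) ≪≫
    Functor.isoWhiskerLeft (Φ.inv ⋙ shiftFunctor D (1 : ℤ)) η

end Hereditary

/-! ### Paths in hereditary triangulated categories -/

section Degrees

set_option linter.unusedSectionVars false

open Pretriangulated Triangulated DerivedCategory DerivedCategory.TStructure

universe w

variable {D : Type u} [Category.{v} D] [Preadditive D] [HasZeroObject D] [HasShift D ℤ]
  [∀ n : ℤ, (shiftFunctor D n).Additive] [Pretriangulated D]
  {A : Type u} [Category.{v} A] [Abelian A] [HasDerivedCategory.{w} A]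

/-- With respect to a functor `G` to a derived category, an object is of degree `n` if its image
is the shift by `n` of an object of the heart. -/
def HasDegree (G : D ⥤ DerivedCategory A) (n : ℤ) : ObjectProperty D := fun Z ↦
  ∃ X : A, Nonempty (G.obj Z ≅ ((singleFunctor A 0).obj X)⟦n⟧)

namespace HasDegree

variable {G : D ⥤ DerivedCategory A} [G.Full] [G.Faithful] [G.Additive]

lemma of_iso {Z Z' : D} (e : Z ≅ Z') {n : ℤ} (h : HasDegree G n Z) : HasDegree G n Z' := by
  obtain ⟨X, ⟨i⟩⟩ := h
  exact ⟨X, ⟨G.mapIso e.symm ≪≫ i⟩⟩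

lemma shift_one (c : shiftFunctor D (1 : ℤ) ⋙ G ≅ G ⋙ shiftFunctor (DerivedCategory A) (1 : ℤ))
    {Z : D} {n : ℤ} (h : HasDegree G n Z) : HasDegree G (n + 1) (Z⟦(1 : ℤ)⟧) := by
  obtain ⟨X, ⟨i⟩⟩ := h
  exact ⟨X, ⟨c.app Z ≪≫ (shiftFunctor _ (1 : ℤ)).mapIso i ≪≫
    ((shiftFunctorAdd' _ n 1 (n + 1) rfl).app _).symm⟩⟩

lemma le_of_hom (hA : IsHereditaryAbelian A) {Z Z' : D} {n n' : ℤ} (h : HasDegree G n Z)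
    (h' : HasDegree G n' Z') (f : Z ⟶ Z') (hf : f ≠ 0) : n ≤ n' := by
  obtain ⟨X, ⟨i⟩⟩ := h
  obtain ⟨X', ⟨i'⟩⟩ := h'
  by_contra! hn
  have h : i.inv ≫ G.map f ≫ i'.hom = 0 :=
    (isHereditaryImage_singleFunctor hA).eq_zero _ (by lia) (by lia)
  apply hf
  apply G.map_injective
  rw [← cancel_mono i'.hom, ← cancel_epi i.inv, h]
  simp

lemma exists_of_indecomposable (hA : IsHereditaryAbelian A)
    (hG : ∀ K : DerivedCategory A, t.bounded K ↔ G.essImage K) {Z : D} (hZ : Indecomposable Z) :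
    ∃ n, HasDegree G n Z := by
  have := preservesBinaryBiproducts_of_preservesBiproducts G
  let Q : ObjectProperty (DerivedCategory A) := fun K ↦
    ∃ Y : D, Nonempty (K ≅ G.obj Y) ∧ IsFiniteSum (fun W ↦ ∃ n, HasDegree G n W) Y
  have : Q.IsClosedUnderIsomorphisms := ⟨fun e ⟨Y, ⟨i⟩, hY⟩ ↦ ⟨Y, ⟨e.symm ≪≫ i⟩, hY⟩⟩
  obtain ⟨Y, ⟨i⟩, hY⟩ : Q (G.obj Z) := by
    refine (isFiniteSum_of_bounded hA ((hG _).2 (G.obj_mem_essImage Z))).le_of_closed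
      (fun X hX ↦ ⟨_, ⟨hX.iso (G.map_isZero (isZero_zero D))⟩, .zero (isZero_zero D)⟩)
      (fun X Y ⟨X', ⟨e⟩, hX⟩ ⟨Y', ⟨e'⟩, hY⟩ ↦
        ⟨X' ⊞ Y', ⟨biprod.mapIso e e' ≪≫ (G.mapBiprod X' Y').symm⟩, hX.biprod hY⟩)
      (fun W ⟨X, n, ⟨e⟩⟩ ↦ ?_)
    obtain ⟨Y, ⟨i⟩⟩ := (hG _).1 (bounded_shift_singleFunctor X n)
    exact ⟨Y, ⟨e ≪≫ i.symm⟩, .of_prop ⟨n, X, ⟨i⟩⟩⟩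
  obtain ⟨B, ⟨n, hB⟩, ⟨e⟩⟩ := hZ.exists_iso_of_isFiniteSum (hY.of_iso (G.preimageIso i).symm)
  exact ⟨n, hB.of_iso e.symm⟩

/-- Degrees do not decrease along paths. -/
lemma le_of_hasPath (hA : IsHereditaryAbelian A)
    (hG : ∀ K : DerivedCategory A, t.bounded K ↔ G.essImage K)
    (c : shiftFunctor D (1 : ℤ) ⋙ G ≅ G ⋙ shiftFunctor (DerivedCategory A) (1 : ℤ)) {Z Z' : D}
    (hZZ' : HasPath Z Z') {n n' : ℤ} (h : HasDegree G n Z) (h' : HasDegree G n' Z') : n ≤ n' := by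
  obtain ⟨hZ, hZZ'⟩ := hasPath_iff.1 hZZ'
  have id_ne_zero {Y : D} (hY : Indecomposable Y) : 𝟙 Y ≠ 0 :=
    fun h ↦ hY.1 ((IsZero.iff_id_eq_zero Y).2 h)
  induction hZZ' generalizing n' with
  | refl => exact h.le_of_hom hA h' _ (id_ne_zero hZ)
  | @tail W Y hZW hWY ih =>
    have hW : HasPath Z W := hasPath_iff.2 ⟨hZ, hZW⟩
    obtain ⟨m, hm⟩ := exists_of_indecomposable hA hG hW.indecomposable_right
    refine (ih hW hm).trans ?_
    obtain ⟨hY, ⟨f, hf⟩ | ⟨⟨e⟩⟩⟩ := hWY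
    · exact hm.le_of_hom hA h' f hf
    · have := (hm.shift_one c).le_of_hom hA (h'.of_iso e) _
        (id_ne_zero (hW.indecomposable_right.shift 1))
      lia

end HasDegree

/-- In a hereditary triangulated category there is no path from the shift of an object to this
object, because the degree with respect to the heart increases by one under the shift. -/
theorem IsHereditaryTriangulated.not_hasPath (h : IsHereditaryTriangulated D) {X : D}
    (hX : Indecomposable X) : ¬ HasPath (X⟦(1 : ℤ)⟧) X := by
  obtain ⟨A, _, _, hA, F, ⟨c⟩⟩ := h
  let _ := HasDerivedCategory.standard A
  let J : Bounded A ⥤ DerivedCategory A := Bounded.ι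
  let G : D ⥤ DerivedCategory A := F.inverse ⋙ J
  have : F.inverse.PreservesZeroMorphisms := inferInstance
  have : F.inverse.Additive := Functor.additive_of_preserves_binary_products _
  have : G.Additive := inferInstanceAs (F.inverse ⋙ J).Additive
  have : G.Full := inferInstanceAs (F.inverse ⋙ J).Full
  have : G.Faithful := inferInstanceAs (F.inverse ⋙ J).Faithful
  have hG (K : DerivedCategory A) : t.bounded K ↔ G.essImage K :=
    ⟨fun hK ↦ ⟨F.functor.obj ⟨K, hK⟩, ⟨J.mapIso (F.unitIso.symm.app ⟨K, hK⟩)⟩⟩,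
      fun ⟨Y, ⟨e⟩⟩ ↦ t.bounded.prop_of_iso e (F.inverse.obj Y).2⟩
  let d : shiftFunctor D (1 : ℤ) ⋙ G ≅ G ⋙ shiftFunctor (DerivedCategory A) (1 : ℤ) :=
    Functor.isoWhiskerRight F.counitIso.symm (shiftFunctor D (1 : ℤ) ⋙ G) ≪≫
      Functor.isoWhiskerLeft F.inverse (Functor.isoWhiskerRight c.symm G) ≪≫
      Functor.isoWhiskerLeft (F.inverse ⋙ shiftFunctor (Bounded A) (1 : ℤ))
        (Functor.isoWhiskerRight F.unitIso.symm J) ≪≫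
      Functor.isoWhiskerLeft F.inverse (Bounded.ι.commShiftIso (1 : ℤ))
  intro hXX
  obtain ⟨n, hn⟩ := HasDegree.exists_of_indecomposable hA hG hX
  have := HasDegree.le_of_hasPath hA hG d hXX (hn.shift_one d) hn
  lia

end Degrees

theorem theorem5p1 (D : Type u) [Category.{v} D] [Preadditive D] [HasZeroObject D]
    [HasShift D ℤ] [∀ n : ℤ, (shiftFunctor D n).Additive] [Pretriangulated D]
    [IsTriangulated D] (hD : HasIndecomposableDecompositions D) (hblock : IsBlock D) :
    List.TFAE [
      IsHereditaryTriangulated D,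
      ∀ X : D, Indecomposable X → ¬ HasPath (X⟦(1 : ℤ)⟧) X,
      ∃ X : D, Indecomposable X ∧ ¬ HasPath (X⟦(1 : ℤ)⟧) X,
      ∃ X Y : D, Indecomposable X ∧ Indecomposable Y ∧ ¬ HasPath Y X] := by
  obtain ⟨X₀, hX₀⟩ : ∃ X : D, Indecomposable X := by
    obtain ⟨Z, hZ⟩ := hblock.exists_not_isZero
    obtain ⟨n, W, hW, ⟨e⟩⟩ := hD Z
    cases (IsFiniteSum.of_biproduct (P := Indecomposable) W hW).of_iso e.symm with
    | zero h => exact (hZ h).elim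
    | @add _ A B hA hB e => exact ⟨B, hB⟩
  tfae_have 1 → 2 := fun h X hX ↦ h.not_hasPath hX
  tfae_have 2 → 3 := fun h ↦ ⟨X₀, hX₀, h X₀ hX₀⟩
  tfae_have 3 → 4 := fun ⟨X, hX, h⟩ ↦ ⟨X, X⟦(1 : ℤ)⟧, hX, hX.shift 1, h⟩
  tfae_have 4 → 2 := fun ⟨X, Y, hX, hY, h⟩ Z hZ hZZ ↦
    h (hblock.hasPath_of_hasPath_shift hD hZZ hX hY)
  tfae_have 2 → 1 := by
    intro hno
    have hP := IsPathFront.isHereditaryHeart hD hno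
      fun Y hY ↦ hblock.isLinked hD hX₀ hY
    obtain ⟨A, _, _, S, _, _, _, hS, hS', hPS⟩ := hP.exists_abelian
    refine hS.isHereditaryTriangulated hS' fun Z ↦ (hP.isFiniteSum Z).mono ?_
    rintro W ⟨B, n, hB, ⟨e⟩⟩
    obtain ⟨X, ⟨i⟩⟩ := hPS B hB
    exact ⟨X, n, ⟨e ≪≫ (shiftFunctor D n).mapIso i⟩⟩
  tfae_finish
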